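/- Let $J\ge 1$ and $d\ge 0$ be integers, and for $1\le j\le J$, $1\le i\le d$ and each prime $p$ let $\alpha_{j,i}(p)\in\mathbb{C}$ be the local roots of the Euler products $L_j(s)=\prod_p\prod_{i=1}^d(1-\alpha_{j,i}(p)p^{-s})^{-1}$. For $k\ge 1$ put $\beta_{L_j}(p^k)=\frac1k\sum_{i=1}^d\alpha_{j,i}(p)^k$. Assume: (i) $|\alpha_{j,i}(p)|\le p^{\theta}$ for all $i,j,p$, for some fixed $0\le\theta<1/2$; (ii) for every $\delta>0$ and every $j$, $\sum_{p\le x}\sum_{i=1}^d|\alpha_{j,i}(p)|^2=O(x^{1+\delta})$ as $x\to\infty$; (iii) there are constants $\xi_j>0$ and $c_{j,k}\in\mathbb{C}$ such that for all $1\le j,k\le J$, as $x\to\infty$, $$\sum_{p\le x}\frac{\beta_{L_j}(p)\overline{\beta_{L_k}(p)}}{p}=\delta_{j,k}\,\xi_j\log\log x+c_{j,k}+O\Big(\frac1{\log x}\Big),$$ where $\delta_{j,k}=1$ if $j=k$ and $\delta_{j,k}=0$ otherwise. Let $\mathbb{X}=\{\mathbb{X}(p)\}_p$ be independent random variables indexed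 by the primes, each uniformly distributed on the unit circle. For $\sigma>1/2$ let $$L_j(\sigma,\mathbb{X})=\prod_p\prod_{i=1}^d\Big(1-\frac{\alpha_{j,i}(p)\mathbb{X}(p)}{p^\sigma}\Big)^{-1},\qquad \log L_j(\sigma,\mathbb{X})=\sum_p\sum_{k\ge 1}\frac{\beta_{L_j}(p^k)\mathbb{X}(p)^k}{p^{k\sigma}},$$ where the product and the sum over $p$ are limits as $N\to\infty$ of those over $p\le N$. Put $\arg L_j(\sigma,\mathbb{X})=\operatorname{Im}\log L_j(\sigma,\mathbb{X})$ and $$\mathbf{L}(\sigma,\mathbb{X})=\big(\log|L_1(\sigma,\mathbb{X})|,\dots,\log|L_J(\sigma,\mathbb{X})|,\arg L_1(\sigma,\mathbb{X}),\dots,\arg L_J(\sigma,\mathbb{X})\big)\in\mathbb{R}^{2J}.$$ For nonzero real numbers $b_1,\dots,b_J$ with $\sum_{j}b_j^2=1$ let $F(\sigma,\mathbb{X})=\sum_{j=1}^J b_jL_j(\sigma,\mathbb{X})$. Then for every $\sigma>1/2$ these products and sums converge almost surely, with $\exp(\log L_j(\sigma,\mathbb{X}))=L_j(\sigma,\mathbb{X})$.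 Moreover, for every real $\sigma_0$ there is a constant $C>0$, depending only on $\sigma_0$ and the $\alpha_{j,i}(p)$ (hence also on $J$), such that for all such $b_1,\dots,b_J$, all $1/2<\sigma\le\sigma_0$ and all $\varepsilon>0$, $R>0$, $M>2\pi$, $$\mathbb{P}\Big(\mathbf{L}(\sigma,\mathbb{X})\in[-M,M]^{2J}\ \text{ and }\ R<|F(\sigma,\mathbb{X})|<R+\varepsilon\Big)\le C\,M^{2J-1}e^{2M}(R\varepsilon+\varepsilon^2).$$ -/

import Mathlib

open MeasureTheory ProbabilityTheory Filter Topology Asymptotics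

/-- The (finite) set of primes `p ≤ N`. -/
def primesUpTo (N : ℕ) : Finset Nat.Primes :=
  (Finset.range (N + 1)).subtype Nat.Prime

section EulerData

variable {J d : ℕ}

/-- The coefficients `β_{L_j}(p ^ k) = (1 / k) ∑_{i ≤ d} α_{j,i}(p) ^ k` (for `k ≥ 1`) of
`log L_j(s) = ∑_p ∑_{k ≥ 1} β_{L_j}(p ^ k) p ^ (-k s)`, where
`L_j(s) = ∏_p ∏_{i ≤ d} (1 - α_{j,i}(p) p ^ (-s))⁻¹`. Here `α j p i` stands for `α_{j,i}(p)`. -/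
noncomputable def primePowerCoeff (α : Fin J → Nat.Primes → Fin d → ℂ)
    (j : Fin J) (p : Nat.Primes) (k : ℕ) : ℂ :=
  (1 / (k : ℂ)) * ∑ i, α j p i ^ k

/-- The bound on the local roots in the Euler product assumption:
`|α_{j,i}(p)| ≤ p ^ θ` for all `j`, `i`, `p`. -/
def LocalRootBound (α : Fin J → Nat.Primes → Fin d → ℂ) (θ : ℝ) : Prop :=
  ∀ j p i, ‖α j p i‖ ≤ ((p : ℕ) : ℝ) ^ θ

/-- Ramanujan hypothesis on average:
`∑_{p ≤ x} ∑_i |α_{j,i}(p)| ^ 2 = O(x ^ (1 + δ))` as `x → ∞`, for all `δ > 0` and all `j`. -/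
def RamanujanOnAverage (α : Fin J → Nat.Primes → Fin d → ℂ) : Prop :=
  ∀ δ : ℝ, 0 < δ → ∀ j,
    (fun x : ℝ => ∑ p ∈ primesUpTo ⌊x⌋₊, ∑ i, ‖α j p i‖ ^ 2) =O[atTop]
      (fun x : ℝ => x ^ (1 + δ))

/-- Selberg orthonormality with constants `ξ_j` and `c_{j,k}`:
`∑_{p ≤ x} β_{L_j}(p) conj(β_{L_k}(p)) / p = δ_{j,k} ξ_j log log x + c_{j,k} + O(1 / log x)`
as `x → ∞`, for all `j`, `k`. -/
def SelbergOrthonormality (α : Fin J → Nat.Primes → Fin d → ℂ)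
    (ξ : Fin J → ℝ) (c : Fin J → Fin J → ℂ) : Prop :=
  ∀ j k,
    (fun x : ℝ =>
      (∑ p ∈ primesUpTo ⌊x⌋₊,
        primePowerCoeff α j p 1 * (starRingEnd ℂ) (primePowerCoeff α k p 1) / ((p : ℕ) : ℂ))
      - ((if j = k then ((ξ j * Real.log (Real.log x) : ℝ) : ℂ) else 0) + c j k)) =O[atTop]
      (fun x : ℝ => 1 / Real.log x)

end EulerData

/-- The uniform probability distribution on the unit circle of `ℂ`:
the law of `exp(2 π i t)` for `t` uniform on `(0, 1]`. -/
noncomputable def unitCircleUniform : Measure ℂ :=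
  (volume.restrict (Set.Ioc (0 : ℝ) 1)).map
    (fun t : ℝ => Complex.exp (2 * Real.pi * t * Complex.I))

/-- `X = (X(p))_p` is a sequence of independent random variables indexed by the primes, each
uniformly distributed on the unit circle. -/
structure IsRandomUnitSequence {Ω : Type*} [MeasurableSpace Ω] (P : Measure Ω)
    (X : Nat.Primes → Ω → ℂ) : Prop where
  indep : iIndepFun X P
  law : ∀ p, HasLaw (X p) unitCircleUniform P

section RandomModel

variable {J d : ℕ} {Ω : Type*}

/-- Truncated random Euler product
`∏_{p ≤ N} ∏_{i ≤ d} (1 - α_{j,i}(p) X(p) / p ^ σ)⁻¹`. -/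
noncomputable def partialRandomL (α : Fin J → Nat.Primes → Fin d → ℂ) (X : Nat.Primes → Ω → ℂ)
    (σ : ℝ) (j : Fin J) (N : ℕ) (ω : Ω) : ℂ :=
  ∏ p ∈ primesUpTo N, ∏ i, (1 - α j p i * X p ω / ((((p : ℕ) : ℝ) ^ σ : ℝ) : ℂ))⁻¹

/-- The random Euler product `L_j(σ, X)`, as the limit of its truncations. -/
noncomputable def randomL (α : Fin J → Nat.Primes → Fin d → ℂ) (X : Nat.Primes → Ω → ℂ)
    (σ : ℝ) (j : Fin J) (ω : Ω) : ℂ :=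
  limUnder atTop (fun N : ℕ => partialRandomL α X σ j N ω)

/-- Truncated logarithm
`∑_{p ≤ N} ∑_{k ≥ 1} β_{L_j}(p ^ k) X(p) ^ k / p ^ (k σ)`. -/
noncomputable def partialRandomLogL (α : Fin J → Nat.Primes → Fin d → ℂ)
    (X : Nat.Primes → Ω → ℂ) (σ : ℝ) (j : Fin J) (N : ℕ) (ω : Ω) : ℂ :=
  ∑ p ∈ primesUpTo N, ∑' k : ℕ,
    primePowerCoeff α j p (k + 1) * X p ω ^ (k + 1) /
      ((((p : ℕ) : ℝ) ^ (((k + 1 : ℕ) : ℝ) * σ) : ℝ) : ℂ)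

/-- The logarithm `log L_j(σ, X) = ∑_p ∑_{k ≥ 1} β_{L_j}(p ^ k) X(p) ^ k / p ^ (k σ)`,
as the limit of its truncations. -/
noncomputable def randomLogL (α : Fin J → Nat.Primes → Fin d → ℂ) (X : Nat.Primes → Ω → ℂ)
    (σ : ℝ) (j : Fin J) (ω : Ω) : ℂ :=
  limUnder atTop (fun N : ℕ => partialRandomLogL α X σ j N ω)

/-- The random vector
`𝐋(σ, X) = (log |L_1(σ, X)|, …, log |L_J(σ, X)|, arg L_1(σ, X), …, arg L_J(σ, X))`,
where `arg L_j(σ, X) = Im log L_j(σ, X)`. The left summand of the index type carries the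
logarithms of the absolute values, the right one the arguments. -/
noncomputable def randomVector (α : Fin J → Nat.Primes → Fin d → ℂ) (X : Nat.Primes → Ω → ℂ)
    (σ : ℝ) (ω : Ω) : Fin J ⊕ Fin J → ℝ :=
  Sum.elim (fun j => Real.log ‖randomL α X σ j ω‖) (fun j => (randomLogL α X σ j ω).im)

/-- The random model `F(σ, X) = ∑_j b_j L_j(σ, X)`. -/
noncomputable def randomF (α : Fin J → Nat.Primes → Fin d → ℂ) (b : Fin J → ℝ)
    (X : Nat.Primes → Ω → ℂ) (σ : ℝ) (ω : Ω) : ℂ :=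
  ∑ j, (b j : ℂ) * randomL α X σ j ω

end RandomModel

/-! The estimate splits into a probabilistic half and a geometric half. The law of the vector of the
`log L_j(σ, X)` on `ℂ^J` has a density bounded uniformly for `1/2 < σ ≤ σ₀`
(`exists_measure_randomLogVector_le`), so the probability is at most a constant times the volume of
the set of `z` in a box with `R < |∑ b_j e^{z_j}| < R + ε`. That volume is elementary
(`volume_box_inter_expSum_annulus_le`): freeze all coordinates but one, and use `ζ = b_j e^{z_j}` to
map horizontal strips of height `2π` injectively into an annulus, with Jacobian at least `b_j²
e^{-2M}`. Some `b_j²` is at least `1/J`, which removes the dependence on `b`.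

The density is bounded because the characteristic function is dominated by an integrable function
(`measure_le_of_norm_charFun_le`). By independence it is a limit of products of local factors, each
of modulus at most one. At a prime where the linear term `∑ w_j β_j(p)` outweighs the quadratic
remainder, the phase is close to a sinusoid, its first two derivatives never vanish together, and a
van der Corput estimate gives decay `|t|^{-1/2}` (`norm_integral_cexp_le`,
`norm_integral_cexp_localLog_le`).

Every direction has infinitely many such primes: orthonormality makes `∑ |∑ w_j β_j(p)|² / p`
diverge, while the root bound and the average Ramanujan bound make the contribution of all other
primes converge. Compactness of the unit sphere then yields one finite set of primes containing, for
each direction, as many good primes as integrability requires.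

Almost sure convergence follows from Kolmogorov's one-series theorem for the linear terms and
absolute convergence of the rest. -/

/-! ### Oscillatory integrals with periodic phase. -/

section Oscillatory

/-- A function on an interval whose antiderivative takes equal values at the end points may be
subtracted without changing the integral. -/
theorem intervalIntegral_sub_deriv_eq {E : Type*} [NormedAddCommGroup E] [NormedSpace ℝ E]
    [CompleteSpace E] {a b : ℝ} {f w w' : ℝ → E} (hf : Continuous f) (hw' : Continuous w')
    (hw : ∀ t, HasDerivAt w (w' t) t) (hper : w b = w a) :
    ∫ t in a..b, (f t - w' t) = ∫ t in a..b, f t := by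
  rw [intervalIntegral.integral_sub (hf.intervalIntegrable _ _) (hw'.intervalIntegrable _ _),
    intervalIntegral.integral_eq_sub_of_hasDerivAt (fun t _ => hw t)
      (hw'.intervalIntegrable _ _), hper, sub_self, sub_zero]

/-- If `g' ^ 2 + g'' ^ 2` is bounded below, then `g'` is rarely small. -/
theorem integral_inv_sq_add_le {a b c K δ : ℝ} (hab : a ≤ b) {g₁ g₂ g₃ : ℝ → ℝ}
    (h1 : ∀ t, HasDerivAt g₁ (g₂ t) t) (h2 : ∀ t, HasDerivAt g₂ (g₃ t) t)
    (h3 : Continuous g₃) (p1 : g₁ b = g₁ a) (p2 : g₂ b = g₂ a) (hc : 0 < c)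
    (hlow : ∀ t, c ^ 2 ≤ g₁ t ^ 2 + g₂ t ^ 2) (hK3 : ∀ t, |g₃ t| ≤ K) (hδ : 0 < δ) (hδ1 : δ ≤ 1) :
    ∫ t in a..b, 1 / (g₁ t ^ 2 + δ ^ 2) ≤ (b - a) * ((1 + 2 * K) / c ^ 2) / δ := by
  have hpos : ∀ t, 0 < g₁ t ^ 2 + δ ^ 2 := fun t => by positivity
  have c1 : Continuous g₁ := continuous_iff_continuousAt.2 fun t => (h1 t).continuousAt
  have c2 : Continuous g₂ := continuous_iff_continuousAt.2 fun t => (h2 t).continuousAt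
  have hK : 0 ≤ K := (abs_nonneg _).trans (hK3 a)
  -- `A` is an antiderivative of `g₂ / (g₁² + δ²)`, of size at most `2 / δ`.
  set A : ℝ → ℝ := fun t => Real.arctan (g₁ t / δ) / δ with hA
  have hAd : ∀ t, HasDerivAt A (g₂ t / (g₁ t ^ 2 + δ ^ 2)) t := by
    intro t
    have := (((h1 t).div_const δ).arctan).div_const δ
    refine this.congr_deriv ?_
    have := (hpos t).ne'
    have h' : (1 + (g₁ t / δ) ^ 2) ≠ 0 := by positivity
    field_simp
    ring
  have cA : Continuous A := continuous_iff_continuousAt.2 fun t => (hAd t).continuousAt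
  set W' : ℝ → ℝ := fun t => g₃ t * A t + g₂ t * (g₂ t / (g₁ t ^ 2 + δ ^ 2)) with hW'
  have hW : ∀ t, HasDerivAt (fun t => g₂ t * A t) (W' t) t := fun t => (h2 t).mul (hAd t)
  have cinv : Continuous fun t => 1 / (g₁ t ^ 2 + δ ^ 2) :=
    continuous_const.div (by fun_prop) fun t => (hpos t).ne'
  have cW' : Continuous W' :=
    (h3.mul cA).add (c2.mul (c2.div (by fun_prop) fun t => (hpos t).ne'))
  have hc2 : 0 < c ^ 2 := by positivity
  -- The lower bound on `g₁² + g₂²` gives `c² / (g₁² + δ²) ≤ 1 + g₂² / (g₁² + δ²)`, and the last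
  -- fraction is `W' - g₃ A`. Subtracting the exact derivative `W' / c²` therefore leaves only
  -- `O(1/δ)`.
  have key : ∀ t, 1 / (g₁ t ^ 2 + δ ^ 2) - (-(1 / c ^ 2) * W' t) * (-1) ≤
      (1 + 2 * K) / c ^ 2 / δ := by
    intro t
    have hAt : |A t| ≤ 2 / δ := by
      rw [hA]
      simp only [abs_div, abs_of_pos hδ]
      gcongr
      have := Real.arctan_lt_pi_div_two (g₁ t / δ)
      have := Real.neg_pi_div_two_lt_arctan (g₁ t / δ)
      have := Real.pi_lt_four
      rw [abs_le]; constructor <;> linarith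
    have h3A : -(g₃ t * A t) ≤ K * (2 / δ) := by
      refine (neg_le_abs _).trans ?_
      rw [abs_mul]
      exact mul_le_mul (hK3 t) hAt (abs_nonneg _) hK
    have e1 : c ^ 2 * (1 / (g₁ t ^ 2 + δ ^ 2)) ≤ 1 + g₂ t * (g₂ t / (g₁ t ^ 2 + δ ^ 2)) := by
      rw [mul_one_div, div_le_iff₀ (hpos t)]
      have := hpos t
      have : g₂ t * (g₂ t / (g₁ t ^ 2 + δ ^ 2)) * (g₁ t ^ 2 + δ ^ 2) = g₂ t ^ 2 := by
        field_simp
      nlinarith [hlow t, sq_nonneg δ]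
    have e2 : (1 : ℝ) ≤ 1 / δ := by rw [le_div_iff₀ hδ]; linarith
    have e3 : (1 + 2 * K) / c ^ 2 / δ = (1 / δ + K * (2 / δ)) / c ^ 2 := by
      field_simp
    rw [e3, le_div_iff₀ hc2]
    have e4 : (1 / (g₁ t ^ 2 + δ ^ 2) - (-(1 / c ^ 2) * W' t) * (-1)) * c ^ 2 =
        c ^ 2 * (1 / (g₁ t ^ 2 + δ ^ 2)) - W' t := by
      field_simp
    rw [e4, hW']
    simp only
    linarith
  calc ∫ t in a..b, 1 / (g₁ t ^ 2 + δ ^ 2)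
      = ∫ t in a..b, (1 / (g₁ t ^ 2 + δ ^ 2) - (-(1 / c ^ 2) * W' t) * (-1)) := by
        refine (intervalIntegral_sub_deriv_eq
          (w := fun t => (-(1 / c ^ 2) * (g₂ t * A t)) * (-1)) cinv ?_ ?_ ?_).symm
        · fun_prop
        · intro t
          exact ((hW t).const_mul _).mul_const _
        · simp only [hA, p1, p2]
    _ ≤ ∫ t in a..b, (1 + 2 * K) / c ^ 2 / δ := by
        refine intervalIntegral.integral_mono_on hab ?_ ?_ fun t _ => key t
        · exact (by fun_prop : Continuous _).intervalIntegrable _ _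
        · exact continuous_const.intervalIntegrable _ _
    _ = _ := by
        rw [intervalIntegral.integral_const, smul_eq_mul]; ring

/-- A van der Corput type bound for periodic phases whose first two derivatives do not vanish
simultaneously. -/
theorem norm_integral_cexp_le {a b c K T : ℝ} (hab : a ≤ b) {g g₁ g₂ g₃ : ℝ → ℝ}
    (h0 : ∀ t, HasDerivAt g (g₁ t) t)
    (h1 : ∀ t, HasDerivAt g₁ (g₂ t) t) (h2 : ∀ t, HasDerivAt g₂ (g₃ t) t)
    (h3 : Continuous g₃) (p0 : g b = g a) (p1 : g₁ b = g₁ a) (p2 : g₂ b = g₂ a) (hc : 0 < c)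
    (hlow : ∀ t, c ^ 2 ≤ g₁ t ^ 2 + g₂ t ^ 2) (hK2 : ∀ t, |g₂ t| ≤ K) (hK3 : ∀ t, |g₃ t| ≤ K)
    (hT : 1 ≤ T) :
    ‖∫ t in a..b, Complex.exp ((T * g t : ℝ) * Complex.I)‖ ≤
      (1 + K) * ((b - a) * ((1 + 2 * K) / c ^ 2)) / √T := by
  have hT0 : 0 < T := by linarith
  -- With `δ² = 1/T`, the two errors made below, `δ² / (g₁² + δ²)` and `|u'| / T`, have the same
  -- order.
  set δ : ℝ := 1 / √T with hδdef
  have hδ : 0 < δ := by positivity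
  have hδ1 : δ ≤ 1 := by
    rw [hδdef, div_le_one (by positivity)]; exact Real.one_le_sqrt.2 hT
  have hδ2 : δ ^ 2 = 1 / T := by rw [hδdef, div_pow, one_pow, Real.sq_sqrt hT0.le]
  have hpos : ∀ t, 0 < g₁ t ^ 2 + δ ^ 2 := fun t => by positivity
  have c0 : Continuous g := continuous_iff_continuousAt.2 fun t => (h0 t).continuousAt
  have c1 : Continuous g₁ := continuous_iff_continuousAt.2 fun t => (h1 t).continuousAt
  have c2 : Continuous g₂ := continuous_iff_continuousAt.2 fun t => (h2 t).continuousAt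
  have hK : 0 ≤ K := (abs_nonneg _).trans (hK2 a)
  set v : ℝ → ℂ := fun t => Complex.exp ((T * g t : ℝ) * Complex.I) with hv
  have hvn : ∀ t, ‖v t‖ = 1 := fun t => Complex.norm_exp_ofReal_mul_I _
  have hvd : ∀ t, HasDerivAt v (v t * ((T * g₁ t : ℝ) * Complex.I)) t := fun t =>
    ((((h0 t).const_mul T).ofReal_comp).mul_const Complex.I).cexp
  -- A smoothed `1 / g₁`: integration by parts against `u` remains legitimate at stationary points.
  set u : ℝ → ℝ := fun t => g₁ t / (g₁ t ^ 2 + δ ^ 2) with hu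
  set u' : ℝ → ℝ := fun t =>
    (g₂ t * (g₁ t ^ 2 + δ ^ 2) - g₁ t * (2 * g₁ t * g₂ t)) / (g₁ t ^ 2 + δ ^ 2) ^ 2 with hu'
  have hud : ∀ t, HasDerivAt u (u' t) t := by
    intro t
    have := (h1 t).div (((h1 t).pow 2).add_const (δ ^ 2)) (hpos t).ne'
    refine this.congr_deriv ?_
    simp [hu']
  have cu : Continuous u := continuous_iff_continuousAt.2 fun t => (hud t).continuousAt
  have cu' : Continuous u' :=
    Continuous.div (by fun_prop) (by fun_prop) fun t => (pow_pos (hpos t) 2).ne'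
  have cv : Continuous v := by fun_prop
  have hTI : (T : ℂ) * Complex.I ≠ 0 := by
    simp [hT0.ne']
  set W' : ℝ → ℂ := fun t =>
    ((u' t : ℂ) * v t + (u t : ℂ) * (v t * ((T * g₁ t : ℝ) * Complex.I))) / (T * Complex.I)
  have hWd : ∀ t, HasDerivAt (fun t => (u t : ℂ) * v t / (T * Complex.I)) (W' t) t := fun t =>
    (((hud t).ofReal_comp).mul (hvd t)).div_const _
  have key : ∀ t, ‖v t - W' t‖ ≤ (1 + K) / T * (1 / (g₁ t ^ 2 + δ ^ 2)) := by
    intro t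
    have hne : ((g₁ t : ℂ) ^ 2 + (δ : ℂ) ^ 2) ≠ 0 := by exact_mod_cast (hpos t).ne'
    have hTc : (T : ℂ) ≠ 0 := by exact_mod_cast hT0.ne'
    have e1 : v t - W' t =
        ((δ ^ 2 / (g₁ t ^ 2 + δ ^ 2) : ℝ) : ℂ) * v t - (u' t : ℂ) * v t / (T * Complex.I) := by
      have : W' t = (u' t : ℂ) * v t / (T * Complex.I) + (u t : ℂ) * g₁ t * v t := by
        simp only [W']
        push_cast
        field_simp
      rw [this, hu]
      push_cast
      field_simp
      ring
    have e2 : |u' t| ≤ K * (1 / (g₁ t ^ 2 + δ ^ 2)) := by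
      have : u' t = g₂ t * ((δ ^ 2 - g₁ t ^ 2) / (g₁ t ^ 2 + δ ^ 2) ^ 2) := by
        rw [hu']; ring
      rw [this, abs_mul]
      refine mul_le_mul (hK2 t) ?_ (abs_nonneg _) hK
      rw [abs_div, abs_of_pos (pow_pos (hpos t) 2), div_le_div_iff₀ (pow_pos (hpos t) 2) (hpos t),
        one_mul, pow_two (g₁ t ^ 2 + δ ^ 2)]
      refine mul_le_mul_of_nonneg_right ?_ (hpos t).le
      rw [abs_le]
      constructor <;> nlinarith [sq_nonneg δ, sq_nonneg (g₁ t)]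
    rw [e1]
    refine (norm_sub_le _ _).trans ?_
    rw [norm_mul, norm_div, norm_mul, norm_mul, hvn, Complex.norm_real, Complex.norm_real,
      Complex.norm_real, Complex.norm_I, mul_one, mul_one, mul_one, Real.norm_eq_abs,
      Real.norm_eq_abs, Real.norm_eq_abs, abs_of_pos hT0,
      abs_of_pos (div_pos (by positivity) (hpos t))]
    calc δ ^ 2 / (g₁ t ^ 2 + δ ^ 2) + |u' t| / T
        ≤ δ ^ 2 / (g₁ t ^ 2 + δ ^ 2) + K * (1 / (g₁ t ^ 2 + δ ^ 2)) / T := by gcongr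
      _ = _ := by
        have := (hpos t).ne'
        rw [show δ ^ 2 / (g₁ t ^ 2 + δ ^ 2) = δ ^ 2 * (1 / (g₁ t ^ 2 + δ ^ 2)) by ring, hδ2]
        ring
  have cW' : Continuous W' := by fun_prop
  have cinv : Continuous fun t => 1 / (g₁ t ^ 2 + δ ^ 2) :=
    continuous_const.div (by fun_prop) fun t => (hpos t).ne'
  calc ‖∫ t in a..b, v t‖ = ‖∫ t in a..b, (v t - W' t)‖ := by
        rw [intervalIntegral_sub_deriv_eq cv cW' hWd]
        simp only [hu, hv, p0, p1]
    _ ≤ ∫ t in a..b, (1 + K) / T * (1 / (g₁ t ^ 2 + δ ^ 2)) := by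
        refine intervalIntegral.norm_integral_le_of_norm_le hab
          (Eventually.of_forall fun t _ => key t) ?_
        exact (by fun_prop : Continuous _).intervalIntegrable _ _
    _ = (1 + K) / T * ∫ t in a..b, 1 / (g₁ t ^ 2 + δ ^ 2) := by
        rw [intervalIntegral.integral_const_mul]
    _ ≤ (1 + K) / T * ((b - a) * ((1 + 2 * K) / c ^ 2) / δ) := by
        gcongr
        exact integral_inv_sq_add_le hab h1 h2 h3 p1 p2 hc hlow hK3 hδ hδ1
    _ = _ := by
        rw [hδdef, div_mul_eq_mul_div, div_eq_div_iff hT0.ne' (by positivity)]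
        have : √T ^ 2 = T := Real.sq_sqrt hT0.le
        field_simp
        rw [this]
end Oscillatory

/-! ### Bounded density from an integrable characteristic function. -/

section BoundedDensity
open scoped FourierTransform SchwartzMap InnerProductSpace Manifold ContDiff

variable {V : Type*} [NormedAddCommGroup V] [InnerProductSpace ℝ V] [FiniteDimensional ℝ V]
  [MeasurableSpace V] [BorelSpace V]

/-- Fourier inversion followed by Fubini; the dilation by `2π` reconciles the normalisations of the
Fourier transform and of `charFun`. -/
theorem SchwartzMap.integral_eq_integral_fourier_mul_charFun (μ : Measure V)
    [IsFiniteMeasure μ] (f : 𝓢(V, ℂ)) :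
    ∫ x, f x ∂μ = ∫ ξ, 𝓕 f ξ * charFun μ ((2 * Real.pi) • ξ) := by
  have h1 : ∀ x, f x = ∫ ξ, Complex.exp (⟪x, (2 * Real.pi) • ξ⟫_ℝ * Complex.I) * 𝓕 f ξ := by
    intro x
    have h := FourierTransform.fourierInv_fourier_eq (F := 𝓢(V, ℂ)) f
    conv_lhs => rw [← h]
    rw [SchwartzMap.fourierInv_coe, Real.fourierInv_eq']
    refine integral_congr_ae (Eventually.of_forall fun ξ => ?_)
    simp only [smul_eq_mul, inner_smul_right, real_inner_comm x ξ]
  simp_rw [h1]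
  rw [integral_integral_swap]
  · refine integral_congr_ae (Eventually.of_forall fun ξ => ?_)
    simp only
    rw [integral_mul_const, charFun_apply, mul_comm]
  · have hi : Integrable (fun z : V × V => (1 : ℂ) * 𝓕 f z.2) (μ.prod volume) :=
      Integrable.mul_prod (f := fun _ : V => (1 : ℂ)) (g := fun ξ => 𝓕 f ξ)
        (integrable_const _) (𝓕 f).integrable
    refine hi.norm.mono' ?_ (Eventually.of_forall fun z => ?_)
    · have : Continuous fun z : V × V =>
          Complex.exp (⟪z.1, (2 * Real.pi) • z.2⟫_ℝ * Complex.I) * 𝓕 f z.2 := by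
        have := (𝓕 f).continuous
        fun_prop
      exact this.aestronglyMeasurable
    · simp only [Function.uncurry, norm_mul, Complex.norm_exp_ofReal_mul_I]
      simp

theorem SchwartzMap.norm_integral_le_of_norm_charFun_le (μ : Measure V)
    [IsFiniteMeasure μ] {g : V → ℝ} (hg : Integrable g) (hμ : ∀ t, ‖charFun μ t‖ ≤ g t)
    (f : 𝓢(V, ℂ)) :
    ‖∫ x, f x ∂μ‖ ≤ (∫ ξ, g ((2 * Real.pi) • ξ)) * ∫ x, ‖f x‖ := by
  rw [SchwartzMap.integral_eq_integral_fourier_mul_charFun, ← integral_mul_const]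
  have hg' : Integrable (fun ξ => g ((2 * Real.pi) • ξ)) :=
    hg.comp_smul (by positivity)
  refine norm_integral_le_of_norm_le (hg'.mul_const _) (Eventually.of_forall fun ξ => ?_)
  rw [norm_mul, mul_comm]
  refine mul_le_mul (hμ _) ?_ (norm_nonneg _) ((norm_nonneg _).trans (hμ _))
  rw [SchwartzMap.fourier_coe]
  exact VectorFourier.norm_fourierIntegral_le_integral_norm _ _ _ _ _

/-- A measure whose characteristic function is dominated by an integrable function has a bounded
density with respect to Lebesgue measure. -/
theorem measure_le_of_norm_charFun_le (μ : Measure V)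
    [IsFiniteMeasure μ] {g : V → ℝ} (hg : Integrable g) (hμ : ∀ t, ‖charFun μ t‖ ≤ g t) :
    μ ≤ ENNReal.ofReal (∫ ξ, g ((2 * Real.pi) • ξ)) • volume := by
  set D : ℝ := ∫ ξ, g ((2 * Real.pi) • ξ) with hD
  have hD0 : 0 ≤ D := integral_nonneg fun ξ => (norm_nonneg _).trans (hμ _)
  have hKU : ∀ K U : Set V, IsCompact K → IsOpen U → K ⊆ U →
      μ K ≤ ENNReal.ofReal D * volume U := by
    intro K U hK hU hKU
    obtain ⟨r, hr⟩ := hK.isBounded.subset_ball 0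
    -- A smooth bump between the indicators of `K` and `U`. Intersecting `U` with a ball gives it
    -- compact support, so it is a Schwartz function.
    obtain ⟨f, hf, hfr, hfs, hf1⟩ := exists_contMDiff_support_eq_eq_one_iff (n := ⊤)
      (𝓘(ℝ, V)) (hU.inter Metric.isOpen_ball) hK.isClosed (Set.subset_inter hKU hr)
    have hf01 : ∀ x, 0 ≤ f x ∧ f x ≤ 1 := fun x => hfr ⟨x, rfl⟩
    have hcs : HasCompactSupport f :=
      (isCompact_closedBall (0 : V) r).of_isClosed_subset isClosed_closure
        (closure_minimal (hfs ▸ Set.inter_subset_right.trans Metric.ball_subset_closedBall)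
          Metric.isClosed_closedBall)
    have hcs' : HasCompactSupport (fun x => (f x : ℂ)) :=
      hcs.comp_left (g := fun x : ℝ => (x : ℂ)) (by simp)
    have hfd : ContDiff ℝ ∞ (fun x => (f x : ℂ)) :=
      Complex.ofRealCLM.contDiff.comp hf.contDiff
    have hfc : Continuous f := hf.contDiff.continuous
    have hmain := SchwartzMap.norm_integral_le_of_norm_charFun_le μ hg hμ
      (hcs'.toSchwartzMap hfd)
    have hcoe : ∀ x, (hcs'.toSchwartzMap hfd) x = (f x : ℂ) := fun x => rfl
    simp only [hcoe, integral_complex_ofReal, Complex.norm_real, Real.norm_eq_abs] at hmain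
    rw [abs_of_nonneg (integral_nonneg fun x => (hf01 x).1)] at hmain
    simp only [fun x => abs_of_nonneg (hf01 x).1] at hmain
    rw [← hD] at hmain
    have hμi : Integrable f μ := hfc.integrable_of_hasCompactSupport hcs
    have hvi : Integrable f volume := hfc.integrable_of_hasCompactSupport hcs
    calc μ K = ∫⁻ x, K.indicator 1 x ∂μ := by rw [lintegral_indicator_one hK.measurableSet]
      _ ≤ ∫⁻ x, ENNReal.ofReal (f x) ∂μ := by
        refine lintegral_mono fun x => ?_
        by_cases hx : x ∈ K
        · simp [hx, (hf1 x).1 hx]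
        · simp [hx]
      _ = ENNReal.ofReal (∫ x, f x ∂μ) :=
        (ofReal_integral_eq_lintegral_ofReal hμi (Eventually.of_forall fun x => (hf01 x).1)).symm
      _ ≤ ENNReal.ofReal (D * ∫ x, f x) := ENNReal.ofReal_le_ofReal hmain
      _ = ENNReal.ofReal D * ∫⁻ x, ENNReal.ofReal (f x) := by
        rw [ENNReal.ofReal_mul hD0,
          ofReal_integral_eq_lintegral_ofReal hvi (Eventually.of_forall fun x => (hf01 x).1)]
      _ ≤ ENNReal.ofReal D * ∫⁻ x, U.indicator 1 x := by
        gcongr with x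
        by_cases hx : x ∈ U
        · simpa [hx] using (hf01 x).2
        · have : f x = 0 := by
            rw [← Function.notMem_support, hfs]
            exact fun h => hx h.1
          simp [this]
      _ = _ := by rw [lintegral_indicator_one hU.measurableSet]
  -- Outer regularity of Lebesgue measure lets `U` shrink to `K`; inner regularity of `μ` then
  -- passes to measurable sets.
  have hK' : ∀ K : Set V, IsCompact K → μ K ≤ ENNReal.ofReal D * volume K := by
    intro K hK
    refine ENNReal.le_of_forall_pos_le_add fun ε hε _ => ?_
    obtain ⟨η, hη, hη'⟩ : ∃ η : ENNReal, η ≠ 0 ∧ ENNReal.ofReal D * η ≤ ε := by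
      refine ⟨ε / (ENNReal.ofReal D + 1), ?_, ?_⟩
      · simp [hε.ne']
      · rw [← mul_div_assoc, mul_comm]
        refine ENNReal.div_le_of_le_mul ?_
        gcongr
        exact le_self_add
    obtain ⟨U, hU, hUo, hUv⟩ := K.exists_isOpen_lt_add (μ := volume)
      hK.measure_lt_top.ne hη
    calc μ K ≤ ENNReal.ofReal D * volume U := hKU K U hK hUo hU
      _ ≤ ENNReal.ofReal D * (volume K + η) := by gcongr
      _ = ENNReal.ofReal D * volume K + ENNReal.ofReal D * η := mul_add _ _ _
      _ ≤ _ := by gcongr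
  refine Measure.le_iff.2 fun s hs => ?_
  rw [hs.measure_eq_iSup_isCompact]
  refine iSup₂_le fun K hKs => iSup_le fun hK => (hK' K hK).trans ?_
  rw [Measure.smul_apply, smul_eq_mul]
  gcongr

end BoundedDensity

/-! ### Volume of the set where an exponential sum lies in an annulus. -/

section ExponentialSums

theorem Complex.exp_injOn_strip (a : ℝ) :
    Set.InjOn Complex.exp {z | a ≤ z.im ∧ z.im < a + 2 * Real.pi} := by
  intro x hx y hy h
  obtain ⟨n, hn⟩ := Complex.exp_eq_exp_iff_exists_int.1 h
  have him : x.im = y.im + n * (2 * Real.pi) := by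
    rw [hn]; simp
  have hpi := Real.pi_pos
  have h1 : (n : ℝ) < 1 := by
    by_contra hc
    push Not at hc
    nlinarith [hx.2, hy.1]
  have h2 : (-1 : ℝ) < n := by
    by_contra hc
    push Not at hc
    nlinarith [hx.1, hy.2]
  have : n = 0 := by
    have h1' : n < 1 := by exact_mod_cast h1
    have h2' : -1 < n := by exact_mod_cast h2
    omega
  simpa [this] using hn

theorem hasFDerivAt_const_mul_exp (b z : ℂ) :
    HasFDerivAt (fun z => b * Complex.exp z)
      (ContinuousLinearMap.mul ℝ ℂ (b * Complex.exp z)) z := by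
  have := (((Complex.hasDerivAt_exp z).const_mul b).hasFDerivAt).restrictScalars ℝ
  refine this.congr_fderiv ?_
  ext; simp [mul_comm]

/-- The algebra norm of `ℂ` over `ℝ` is by definition the determinant of multiplication. -/
theorem det_mul_complex (c : ℂ) : (ContinuousLinearMap.mul ℝ ℂ c).det = ‖c‖ ^ 2 := by
  rw [← Complex.normSq_eq_norm_sq, ← Algebra.norm_complex_apply]
  rfl

/-- The area is `π (2Rε + ε²)`, and `π < 4` produces the constant `8`. -/
theorem volume_annulus_le (w : ℂ) {R ε : ℝ} (hR : 0 < R) (hε : 0 < ε) :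
    volume {ζ : ℂ | R < ‖ζ + w‖ ∧ ‖ζ + w‖ < R + ε} ≤
      ENNReal.ofReal (8 * (R * ε + ε ^ 2)) := by
  have hsub : {ζ : ℂ | R < ‖ζ + w‖ ∧ ‖ζ + w‖ < R + ε} ⊆
      Metric.ball (-w) (R + ε) \ Metric.ball (-w) R := by
    intro ζ hζ
    simp only [Set.mem_sdiff, Metric.mem_ball, dist_eq_norm, sub_neg_eq_add, not_lt]
    exact ⟨hζ.2, hζ.1.le⟩
  refine (measure_mono hsub).trans ?_
  rw [measure_sdiff (Metric.ball_subset_ball (by linarith)) measurableSet_ball.nullMeasurableSet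
    measure_ball_lt_top.ne, Complex.volume_ball, Complex.volume_ball]
  have hpi : (NNReal.pi : ENNReal) = ENNReal.ofReal Real.pi := by
    rw [← NNReal.coe_real_pi, ENNReal.ofReal_coe_nnreal]
  rw [hpi, ← ENNReal.ofReal_pow (by positivity), ← ENNReal.ofReal_pow (by positivity),
    ← ENNReal.ofReal_mul (by positivity), ← ENNReal.ofReal_mul (by positivity),
    ← ENNReal.ofReal_sub _ (by positivity)]
  refine ENNReal.ofReal_le_ofReal ?_
  have h4 := Real.pi_lt_four
  have : (R + ε) ^ 2 * Real.pi - R ^ 2 * Real.pi = (2 * (R * ε) + ε ^ 2) * Real.pi := by ring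
  rw [this]
  have h1 : 0 < R * ε := by positivity
  nlinarith [sq_nonneg ε, Real.pi_pos]

/-- The box `|Re z|, |Im z| ≤ M`. -/
def complexBox (M : ℝ) : Set ℂ := {z | |z.re| ≤ M ∧ |z.im| ≤ M}

theorem isClosed_complexBox (M : ℝ) : IsClosed (complexBox M) :=
  IsClosed.inter (s₁ := {z : ℂ | |z.re| ≤ M}) (s₂ := {z : ℂ | |z.im| ≤ M})
    (isClosed_le (by fun_prop) (by fun_prop)) (isClosed_le (by fun_prop) (by fun_prop))

theorem volume_complexBox (M : ℝ) : volume (complexBox M) = ENNReal.ofReal (2 * M) ^ 2 := by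
  have : complexBox M = Complex.measurableEquivRealProd ⁻¹' (Set.Icc (-M) M ×ˢ Set.Icc (-M) M) := by
    ext z
    simp only [complexBox, abs_le, Set.mem_preimage, Complex.measurableEquivRealProd_apply,
      Set.mem_prod, Set.mem_Icc, Set.mem_ofPred_eq]
  rw [this, Complex.volume_preserving_equiv_real_prod.measure_preimage_equiv,
    Measure.volume_eq_prod, Measure.prod_prod, Real.volume_Icc, pow_two]
  congr 2 <;> ring

/-- On a strip of height `2π` the map `z ↦ b e^z` is injective, and in the box its Jacobian `|b
e^z|²` is at least `b² e^{-2M}`. The image lies in an annulus, whose area is known. -/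
theorem volume_strip_le {b M a : ℝ} (hb : b ≠ 0) (w : ℂ) {R ε : ℝ} (hR : 0 < R) (hε : 0 < ε) :
    volume {z : ℂ | z ∈ complexBox M ∧ (R < ‖b * Complex.exp z + w‖ ∧
        ‖b * Complex.exp z + w‖ < R + ε) ∧ a ≤ z.im ∧ z.im < a + 2 * Real.pi} ≤
      ENNReal.ofReal (Real.exp (2 * M) / b ^ 2 * (8 * (R * ε + ε ^ 2))) := by
  set s := {z : ℂ | z ∈ complexBox M ∧ (R < ‖b * Complex.exp z + w‖ ∧
        ‖b * Complex.exp z + w‖ < R + ε) ∧ a ≤ z.im ∧ z.im < a + 2 * Real.pi} with hs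
  have hsm : MeasurableSet s := by
    refine (isClosed_complexBox M).measurableSet.inter (MeasurableSet.inter
      (MeasurableSet.inter ?_ ?_) (MeasurableSet.inter ?_ ?_))
    · exact (isOpen_lt (α := ℝ) (β := ℂ) continuous_const (by fun_prop)).measurableSet
    · exact (isOpen_lt (α := ℝ) (β := ℂ) (by fun_prop) continuous_const).measurableSet
    · exact (isClosed_le continuous_const Complex.continuous_im).measurableSet
    · exact (isOpen_lt Complex.continuous_im continuous_const).measurableSet
  have hbc : (b : ℂ) ≠ 0 := by exact_mod_cast hb
  have hinj : Set.InjOn (fun z : ℂ => (b : ℂ) * Complex.exp z) s := fun x hx y hy h =>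
    Complex.exp_injOn_strip a hx.2.2 hy.2.2 (mul_left_cancel₀ hbc h)
  have hcv := lintegral_abs_det_fderiv_eq_addHaar_image volume hsm
    (fun z _ => (hasFDerivAt_const_mul_exp (b : ℂ) z).hasFDerivWithinAt) hinj
  have himg : (fun z : ℂ => (b : ℂ) * Complex.exp z) '' s ⊆
      {ζ : ℂ | R < ‖ζ + w‖ ∧ ‖ζ + w‖ < R + ε} := by
    rintro _ ⟨z, hz, rfl⟩
    exact hz.2.1
  have hq : 0 < b ^ 2 * Real.exp (-(2 * M)) := by positivity
  have hlow : ENNReal.ofReal (b ^ 2 * Real.exp (-(2 * M))) * volume s ≤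
      ENNReal.ofReal (8 * (R * ε + ε ^ 2)) := by
    calc ENNReal.ofReal (b ^ 2 * Real.exp (-(2 * M))) * volume s
        = ∫⁻ _ in s, ENNReal.ofReal (b ^ 2 * Real.exp (-(2 * M))) := by
          rw [setLIntegral_const]
      _ ≤ ∫⁻ z in s, ENNReal.ofReal
            |(ContinuousLinearMap.mul ℝ ℂ ((b : ℂ) * Complex.exp z)).det| := by
          refine setLIntegral_mono' hsm fun z hz => ENNReal.ofReal_le_ofReal ?_
          rw [det_mul_complex, abs_of_nonneg (sq_nonneg _), norm_mul, mul_pow, Complex.norm_real,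
            Real.norm_eq_abs, sq_abs, Complex.norm_exp, ← Real.exp_nat_mul]
          gcongr
          have := (abs_le.1 hz.1.1).1
          push_cast
          linarith
      _ ≤ _ := hcv.trans_le ((measure_mono himg).trans (volume_annulus_le w hR hε))
  have heq : Real.exp (2 * M) / b ^ 2 = (b ^ 2 * Real.exp (-(2 * M)))⁻¹ := by
    rw [Real.exp_neg, mul_inv, inv_inv]; ring
  rw [heq, ENNReal.ofReal_mul (by positivity), ENNReal.ofReal_inv_of_pos hq]
  rw [← ENNReal.div_eq_inv_mul]
  rw [ENNReal.le_div_iff_mul_le (by left; simpa using hq) (by left; exact ENNReal.ofReal_ne_top),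
    mul_comm]
  exact hlow

theorem volume_complexBox_inter_annulus_le {b M : ℝ} (hb : b ≠ 0) (hM : 2 * Real.pi < M) (w : ℂ)
    {R ε : ℝ} (hR : 0 < R) (hε : 0 < ε) :
    volume {z : ℂ | z ∈ complexBox M ∧ R < ‖b * Complex.exp z + w‖ ∧
        ‖b * Complex.exp z + w‖ < R + ε} ≤
      ENNReal.ofReal (M * (Real.exp (2 * M) / b ^ 2 * (8 * (R * ε + ε ^ 2)))) := by
  have hpi := Real.pi_pos
  have hpi3 := Real.pi_gt_three
  have hM0 : 0 < M := by linarith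
  -- The number of strips needed to cover `|Im z| ≤ M`. It is at most `M / 3 + 1`, hence at most `M`
  -- because `M > 2π`.
  set n : ℕ := ⌊2 * M / (2 * Real.pi)⌋₊ + 1 with hn
  have hnM : (n : ℝ) ≤ M := by
    have h1 : (⌊2 * M / (2 * Real.pi)⌋₊ : ℝ) ≤ 2 * M / (2 * Real.pi) :=
      Nat.floor_le (by positivity)
    have h2 : 2 * M / (2 * Real.pi) ≤ M / 3 := by
      rw [div_le_div_iff₀ (by positivity) (by norm_num)]
      nlinarith
    rw [hn]; push_cast; linarith
  have hcover : {z : ℂ | z ∈ complexBox M ∧ R < ‖b * Complex.exp z + w‖ ∧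
        ‖b * Complex.exp z + w‖ < R + ε} ⊆
      ⋃ k ∈ Finset.range n, {z : ℂ | z ∈ complexBox M ∧ (R < ‖b * Complex.exp z + w‖ ∧
        ‖b * Complex.exp z + w‖ < R + ε) ∧ (-M + 2 * Real.pi * k) ≤ z.im ∧
          z.im < (-M + 2 * Real.pi * k) + 2 * Real.pi} := by
    intro z hz
    have him := abs_le.1 hz.1.2
    have h0 : 0 ≤ (z.im + M) / (2 * Real.pi) := div_nonneg (by linarith) (by positivity)
    simp only [Set.mem_iUnion]
    refine ⟨⌊(z.im + M) / (2 * Real.pi)⌋₊, ?_, hz.1, hz.2, ?_, ?_⟩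
    · rw [Finset.mem_range, hn, Nat.lt_succ_iff]
      apply Nat.floor_le_floor
      gcongr
      linarith
    · have := Nat.floor_le h0
      rw [le_div_iff₀ (by positivity)] at this
      linarith
    · have := Nat.lt_floor_add_one ((z.im + M) / (2 * Real.pi))
      rw [div_lt_iff₀ (by positivity)] at this
      linarith
  refine (measure_mono hcover).trans ((measure_biUnion_finset_le _ _).trans ?_)
  refine (Finset.sum_le_sum fun k _ => volume_strip_le hb w hR hε).trans ?_
  rw [Finset.sum_const, Finset.card_range, nsmul_eq_mul, ENNReal.ofReal_mul hM0.le]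
  gcongr
  rw [← ENNReal.ofReal_natCast]
  exact ENNReal.ofReal_le_ofReal hnM

/-- Fubini with coordinate `j` isolated: the other terms form the shift `w` of the one-variable
bound, and each remaining coordinate contributes the box area `(2M)²`. -/
theorem volume_box_inter_expSum_annulus_le {J : ℕ} {b : Fin J → ℝ} {M : ℝ} (j : Fin J)
    (hb : b j ≠ 0) (hM : 2 * Real.pi < M) {R ε : ℝ} (hR : 0 < R) (hε : 0 < ε) :
    volume {z : Fin J → ℂ | (∀ i, z i ∈ complexBox M) ∧
        R < ‖∑ i, (b i : ℂ) * Complex.exp (z i)‖ ∧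
        ‖∑ i, (b i : ℂ) * Complex.exp (z i)‖ < R + ε} ≤
      ENNReal.ofReal ((2 * M) ^ (2 * J - 2) *
        (M * (Real.exp (2 * M) / b j ^ 2 * (8 * (R * ε + ε ^ 2))))) := by
  have hM0 : 0 < M := by linarith [Real.pi_pos]
  obtain ⟨n, rfl⟩ : ∃ n, J = n + 1 := ⟨J - 1, by have := j.pos; omega⟩
  set E := MeasurableEquiv.piFinSuccAbove (fun _ : Fin (n + 1) => ℂ) j with hE
  set K := M * (Real.exp (2 * M) / b j ^ 2 * (8 * (R * ε + ε ^ 2))) with hK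
  set F : ℂ × (Fin n → ℂ) → ℂ := fun q =>
    (b j : ℂ) * Complex.exp q.1 + ∑ i, (b (j.succAbove i) : ℂ) * Complex.exp (q.2 i) with hF
  set B : Set (ℂ × (Fin n → ℂ)) := {q | (q.1 ∈ complexBox M ∧ ∀ i, q.2 i ∈ complexBox M) ∧
    R < ‖F q‖ ∧ ‖F q‖ < R + ε} with hB
  have hFc : Continuous F := by fun_prop
  have hBm : MeasurableSet B := by
    refine MeasurableSet.inter (MeasurableSet.inter ?_ ?_) (MeasurableSet.inter ?_ ?_)
    · exact ((isClosed_complexBox M).preimage continuous_fst).measurableSet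
    · have : {q : ℂ × (Fin n → ℂ) | ∀ i, q.2 i ∈ complexBox M} =
        ⋂ i, (fun q : ℂ × (Fin n → ℂ) => q.2 i) ⁻¹' complexBox M := by ext; simp
      have h : MeasurableSet {q : ℂ × (Fin n → ℂ) | ∀ i, q.2 i ∈ complexBox M} := by
        rw [this]
        exact (isClosed_iInter fun i =>
          (isClosed_complexBox M).preimage (by fun_prop)).measurableSet
      exact h
    · exact (isOpen_lt continuous_const hFc.norm).measurableSet
    · exact (isOpen_lt hFc.norm continuous_const).measurableSet
  have hpre : {z : Fin (n + 1) → ℂ | (∀ i, z i ∈ complexBox M) ∧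
        R < ‖∑ i, (b i : ℂ) * Complex.exp (z i)‖ ∧
        ‖∑ i, (b i : ℂ) * Complex.exp (z i)‖ < R + ε} = E ⁻¹' B := by
    ext z
    have h1 : (E z).1 = z j := rfl
    have h2 : ∀ i, (E z).2 i = z (j.succAbove i) := fun i => rfl
    simp only [Set.mem_ofPred_eq, Set.mem_preimage, hB, hF, h1, h2,
      Fin.sum_univ_succAbove _ j, Fin.forall_iff_succAbove j]
  rw [hpre, (volume_preserving_piFinSuccAbove (fun _ : Fin (n + 1) => ℂ) j).measure_preimage_equiv,
    Measure.volume_eq_prod, Measure.prod_apply_symm hBm]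
  calc ∫⁻ y, volume ((fun x => (x, y)) ⁻¹' B)
      ≤ ∫⁻ y, (Set.univ.pi fun _ : Fin n => complexBox M).indicator
          (fun _ => ENNReal.ofReal K) y := by
        refine lintegral_mono fun y => ?_
        by_cases hy : y ∈ Set.univ.pi fun _ : Fin n => complexBox M
        · rw [Set.indicator_of_mem hy]
          refine (measure_mono ?_).trans (volume_complexBox_inter_annulus_le hb hM
            (∑ i, (b (j.succAbove i) : ℂ) * Complex.exp (y i)) hR hε)
          intro x hx
          exact ⟨hx.1.1, hx.2⟩
        · rw [Set.indicator_of_notMem hy]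
          have : (fun x => (x, y)) ⁻¹' B = ∅ := by
            ext x
            simp only [Set.mem_preimage, Set.mem_empty_iff_false, iff_false]
            intro hx
            exact hy fun i _ => hx.1.2 i
          rw [this, measure_empty]
    _ = ENNReal.ofReal K * (ENNReal.ofReal (2 * M) ^ 2) ^ n := by
        rw [lintegral_indicator_const, volume_pi, Measure.pi_pi]
        · simp [volume_complexBox]
        · exact MeasurableSet.univ_pi fun _ => (isClosed_complexBox M).measurableSet
    _ = _ := by
        rw [← pow_mul, ← ENNReal.ofReal_pow (by positivity),
          ← ENNReal.ofReal_mul (by positivity), mul_comm]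
        rfl

end ExponentialSums

/-! ### Phases built from logarithms of Euler factors. -/

section LogPhase

variable {ι : Type*} [Fintype ι]

theorem HasDerivAt.re_complex {f : ℝ → ℂ} {f' : ℂ} {t : ℝ} (h : HasDerivAt f f' t) :
    HasDerivAt (fun t => (f t).re) f'.re t :=
  Complex.reCLM.hasFDerivAt.comp_hasDerivAt t h

theorem hasDerivAt_mul_cexp_ofReal_mul_I (c : ℂ) (t : ℝ) :
    HasDerivAt (fun t : ℝ => c * Complex.exp (t * Complex.I))
      (Complex.I * (c * Complex.exp (t * Complex.I))) t := by
  have h1 : HasDerivAt (fun t : ℝ => (t : ℂ) * Complex.I) (1 * Complex.I) t :=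
    (Complex.ofRealCLM.hasDerivAt (x := t)).mul_const _
  exact (h1.cexp.const_mul c).congr_deriv (by ring)

theorem one_sub_ne_zero_of_norm_le {u : ℂ} {ρ : ℝ} (hu : ‖u‖ ≤ ρ) (hρ : ρ < 1) : 1 - u ≠ 0 := by
  intro h
  have : u = 1 := (sub_eq_zero.1 h).symm
  rw [this, norm_one] at hu
  linarith

theorem one_sub_le_norm_one_sub {u : ℂ} {ρ : ℝ} (hu : ‖u‖ ≤ ρ) : 1 - ρ ≤ ‖1 - u‖ := by
  have := norm_sub_norm_le (1 : ℂ) u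
  rw [norm_one] at this
  linarith

theorem norm_re_sum_mul_le {v f : ι → ℂ} {B : ι → ℝ} (hv : ∀ k, ‖v k‖ ≤ 1)
    (hf : ∀ k, ‖f k‖ ≤ B k) : |(∑ k, v k * f k).re| ≤ ∑ k, B k := by
  refine (Complex.abs_re_le_norm _).trans ((norm_sum_le _ _).trans (Finset.sum_le_sum fun k _ => ?_))
  rw [norm_mul]
  calc ‖v k‖ * ‖f k‖ ≤ 1 * ‖f k‖ := by gcongr; exact hv k
    _ ≤ B k := by rw [one_mul]; exact hf k

/-- Decay of the characteristic function of a combination of logarithms of Euler factors whose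
linear terms dominate. -/
theorem norm_integral_cexp_log_le {c v : ι → ℂ} {ρ A T : ℝ} (hρ : ρ < 1)
    (hc : ∀ k, ‖c k‖ ≤ ρ) (hv : ∀ k, ‖v k‖ ≤ 1) (hA : 0 < A) (hA' : A ≤ ‖∑ k, v k * c k‖)
    (hdom : 12 / (1 - ρ) ^ 2 * ∑ k, ‖c k‖ ^ 2 ≤ ‖∑ k, v k * c k‖) (hT : 1 ≤ T) :
    ‖∫ t in (0 : ℝ)..(2 * Real.pi), Complex.exp ((T * (∑ k, v k *
      -Complex.log (1 - c k * Complex.exp (t * Complex.I))).re : ℝ) * Complex.I)‖ ≤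
      (1 + Fintype.card ι * (2 / (1 - ρ) ^ 3)) * (2 * Real.pi *
        ((1 + 2 * (Fintype.card ι * (2 / (1 - ρ) ^ 3))) / (A / 2) ^ 2)) / √T := by
  set u : ι → ℝ → ℂ := fun k t => c k * Complex.exp (t * Complex.I) with hu
  have hun : ∀ k t, ‖u k t‖ = ‖c k‖ := fun k t => by
    simp [hu, Complex.norm_exp_ofReal_mul_I]
  have hul : ∀ k t, ‖u k t‖ ≤ ρ := fun k t => (hun k t).trans_le (hc k)
  have hud : ∀ k t, HasDerivAt (u k) (Complex.I * u k t) t := fun k t =>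
    hasDerivAt_mul_cexp_ofReal_mul_I (c k) t
  have huc : ∀ k, Continuous (u k) := fun k =>
    continuous_iff_continuousAt.2 fun t => (hud k t).continuousAt
  have hne : ∀ k t, 1 - u k t ≠ 0 := fun k t => one_sub_ne_zero_of_norm_le (hul k t) hρ
  have hlow : ∀ k t, 1 - ρ ≤ ‖1 - u k t‖ := fun k t => one_sub_le_norm_one_sub (hul k t)
  have hρ' : 0 < 1 - ρ := by linarith
  have hper : ∀ k, u k (2 * Real.pi) = u k 0 := fun k => by
    simp [hu, Complex.exp_two_pi_mul_I]
  -- The first three derivatives in `t` of `-log (1 - u k t)`, using `u' = i u`.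
  set f₁ : ι → ℝ → ℂ := fun k t => Complex.I * u k t / (1 - u k t) with hf₁
  set f₂ : ι → ℝ → ℂ := fun k t => -u k t / (1 - u k t) ^ 2 with hf₂
  set f₃ : ι → ℝ → ℂ := fun k t => -Complex.I * u k t * (1 + u k t) / (1 - u k t) ^ 3 with hf₃
  have d0 : ∀ k t, HasDerivAt (fun t => -Complex.log (1 - u k t)) (f₁ k t) t := by
    intro k t
    have hs : 1 - u k t ∈ Complex.slitPlane := by
      rw [sub_eq_add_neg]
      refine Complex.mem_slitPlane_of_norm_lt_one ?_
      rw [norm_neg]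
      exact (hul k t).trans_lt hρ
    refine (((hud k t).const_sub 1).clog_real hs).neg.congr_deriv ?_
    simp only [hf₁]
    ring
  have d1 : ∀ k t, HasDerivAt (f₁ k) (f₂ k t) t := by
    intro k t
    refine (((hud k t).const_mul Complex.I).div ((hud k t).const_sub 1) (hne k t)).congr_deriv ?_
    simp only [hf₂]
    congr 1
    linear_combination u k t * Complex.I_sq
  have d2 : ∀ k t, HasDerivAt (f₂ k) (f₃ k t) t := by
    intro k t
    refine ((hud k t).neg.div (((hud k t).const_sub 1).pow 2)
      (pow_ne_zero 2 (hne k t))).congr_deriv ?_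
    simp only [hf₃]
    have := hne k t
    field_simp
    simp
    ring
  have hρ0 : ∀ k, 0 ≤ ρ := fun k => (norm_nonneg _).trans (hc k)
  have hu1 : ∀ k t, ‖u k t‖ ≤ 1 := fun k t => (hul k t).trans hρ.le
  have hK2 : ∀ k t, ‖f₂ k t‖ ≤ 2 / (1 - ρ) ^ 3 := by
    intro k t
    simp only [hf₂, norm_div, norm_neg, norm_pow]
    have h1 : (1 - ρ) ^ 3 ≤ ‖1 - u k t‖ ^ 2 := by
      calc (1 - ρ) ^ 3 ≤ (1 - ρ) ^ 2 :=
            pow_le_pow_of_le_one hρ'.le (by linarith [hρ0 k]) (by norm_num)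
        _ ≤ _ := by gcongr; exact hlow k t
    have := hu1 k t
    gcongr
    linarith
  have hK3 : ∀ k t, ‖f₃ k t‖ ≤ 2 / (1 - ρ) ^ 3 := by
    intro k t
    simp only [hf₃, norm_div, norm_neg, norm_pow, norm_mul, Complex.norm_I, one_mul]
    have h2 : ‖1 + u k t‖ ≤ 2 := (norm_add_le _ _).trans (by rw [norm_one]; linarith [hu1 k t])
    have := hlow k t
    gcongr
    calc ‖u k t‖ * ‖1 + u k t‖ ≤ 1 * 2 := by gcongr; exact hu1 k t
      _ = 2 := by norm_num
  have hsumd : ∀ {F F' : ι → ℝ → ℂ}, (∀ k t, HasDerivAt (F k) (F' k t) t) → ∀ t,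
      HasDerivAt (fun t => (∑ k, v k * F k t).re) (∑ k, v k * F' k t).re t := by
    intro F F' h t
    exact (HasDerivAt.fun_sum fun k _ => (h k t).const_mul (v k)).re_complex
  refine (norm_integral_cexp_le (by positivity) (hsumd d0) (hsumd d1) (hsumd d2) ?_ ?_ ?_ ?_
    (half_pos hA) ?_ ?_ ?_ hT).trans_eq (by rw [sub_zero])
  · refine Complex.continuous_re.comp (continuous_finsetSum _ fun k _ => continuous_const.mul ?_)
    have := huc k
    refine Continuous.div (by fun_prop) (by fun_prop) fun t => pow_ne_zero 3 (hne k t)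
  · simp only [hper]
  · simp only [hf₁, hper]
  · simp only [hf₂, hper]
  -- To first order the phase is `Re a`, whose first two derivatives are `-Im a` and `-Re a`, with
  -- squares summing to `|a|²`. The domination hypothesis keeps both errors below `|a| / 4`, so the
  -- true sum of squares exceeds `(|a| / 2)²`. The factor `12` is `4 · 3`, where `3` bounds `|2 -
  -- u|`.
  · intro t
    set a : ℂ := (∑ k, v k * c k) * Complex.exp (t * Complex.I) with ha
    have han : ‖a‖ = ‖∑ k, v k * c k‖ := by
      rw [ha, norm_mul, Complex.norm_exp_ofReal_mul_I, mul_one]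
    have hau : a = ∑ k, v k * u k t := by
      simp only [ha, hu, Finset.sum_mul, mul_assoc]
    set E : ℝ := ∑ k, 3 / (1 - ρ) ^ 2 * ‖c k‖ ^ 2 with hE
    have hEa : E ≤ ‖a‖ / 4 := by
      rw [han, hE, ← Finset.mul_sum]
      rw [show 12 / (1 - ρ) ^ 2 = 4 * (3 / (1 - ρ) ^ 2) by ring] at hdom
      linarith
    have e1 : |(∑ k, v k * f₁ k t).re - (-a.im)| ≤ E := by
      have : (∑ k, v k * f₁ k t).re - (-a.im) =
          (∑ k, v k * (Complex.I * u k t ^ 2 / (1 - u k t))).re := by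
        have h1 : -a.im = (Complex.I * a).re := by simp
        rw [h1, ← Complex.sub_re, hau, Finset.mul_sum, ← Finset.sum_sub_distrib]
        congr 2
        ext k
        have := hne k t
        simp only [hf₁]
        field_simp
        ring
      rw [this]
      refine norm_re_sum_mul_le hv fun k => ?_
      rw [norm_div, norm_mul, norm_pow, Complex.norm_I, one_mul, hun, div_mul_eq_mul_div]
      have h1 : (1 - ρ) ^ 2 ≤ ‖1 - u k t‖ := by
        calc (1 - ρ) ^ 2 ≤ (1 - ρ) ^ 1 :=
              pow_le_pow_of_le_one hρ'.le (by linarith [hρ0 k]) (by norm_num)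
          _ ≤ _ := by rw [pow_one]; exact hlow k t
      gcongr
      nlinarith [sq_nonneg ‖c k‖]
    have e2 : |(∑ k, v k * f₂ k t).re - (-a.re)| ≤ E := by
      have : (∑ k, v k * f₂ k t).re - (-a.re) =
          (∑ k, v k * (-(u k t ^ 2 * (2 - u k t)) / (1 - u k t) ^ 2)).re := by
        have h1 : -a.re = (-a).re := by simp
        rw [h1, ← Complex.sub_re, hau, ← Finset.sum_neg_distrib, ← Finset.sum_sub_distrib]
        congr 2
        ext k
        have := hne k t
        simp only [hf₂]
        field_simp
        ring
      rw [this]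
      refine norm_re_sum_mul_le hv fun k => ?_
      rw [norm_div, norm_neg, norm_mul, norm_pow, norm_pow, hun, div_mul_eq_mul_div]
      have h2 : ‖2 - u k t‖ ≤ 3 := by
        refine (norm_sub_le _ _).trans ?_
        have : ‖(2 : ℂ)‖ = 2 := by simp
        linarith [hu1 k t]
      have := hlow k t
      rw [mul_comm (‖c k‖ ^ 2)]
      gcongr
    have hna : ‖a‖ ^ 2 = a.re ^ 2 + a.im ^ 2 := by
      rw [← Complex.normSq_eq_norm_sq, Complex.normSq_apply]; ring
    have hAa : A ≤ ‖a‖ := han ▸ hA'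
    set x := (∑ k, v k * f₁ k t).re
    set y := (∑ k, v k * f₂ k t).re
    have hE0 : 0 ≤ E := (abs_nonneg _).trans e1
    have e1' : (x - -a.im) ^ 2 ≤ (‖a‖ / 4) ^ 2 := sq_le_sq' (by linarith [(abs_le.1 e1).1]) (by linarith [(abs_le.1 e1).2])
    have e2' : (y - -a.re) ^ 2 ≤ (‖a‖ / 4) ^ 2 := sq_le_sq' (by linarith [(abs_le.1 e2).1]) (by linarith [(abs_le.1 e2).2])
    have hA2 : A ^ 2 ≤ ‖a‖ ^ 2 := by gcongr
    nlinarith [sq_nonneg (x + (x - -a.im)), sq_nonneg (y + (y - -a.re)), sq_nonneg A,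
      sq_nonneg (x - (x - -a.im) / 2), sq_nonneg (2 * x + a.im), sq_nonneg (2 * y + a.re)]
  · intro t
    refine (norm_re_sum_mul_le hv fun k => hK2 k t).trans_eq ?_
    simp
  · intro t
    refine (norm_re_sum_mul_le hv fun k => hK3 k t).trans_eq ?_
    simp

end LogPhase

/-! ### Local factors and the decay of their characteristic functions. -/

section LocalFactors

variable {J d : ℕ} {α : Fin J → Nat.Primes → Fin d → ℂ} {θ σ : ℝ}

/-- The logarithm of the local factor of `L_j` at `p`, twisted by `z`. -/
noncomputable def localLog (α : Fin J → Nat.Primes → Fin d → ℂ) (σ : ℝ) (j : Fin J)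
    (p : Nat.Primes) (z : ℂ) : ℂ :=
  ∑ i, -Complex.log (1 - α j p i * z / ((((p : ℕ) : ℝ) ^ σ : ℝ) : ℂ))

theorem measurable_localLog (α : Fin J → Nat.Primes → Fin d → ℂ) (σ : ℝ) (j : Fin J)
    (p : Nat.Primes) : Measurable (localLog α σ j p) := by
  unfold localLog
  fun_prop

theorem two_rpow_lt_one (hθ : θ < 1 / 2) : (2 : ℝ) ^ (θ - 1 / 2) < 1 :=
  Real.rpow_lt_one_of_one_lt_of_neg (by norm_num) (by linarith)

theorem Nat.Primes.two_le_cast (p : Nat.Primes) : (2 : ℝ) ≤ ((p : ℕ) : ℝ) := by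
  exact_mod_cast p.2.two_le

theorem Nat.Primes.cast_pos (p : Nat.Primes) : (0 : ℝ) < ((p : ℕ) : ℝ) :=
  lt_of_lt_of_le (by norm_num) p.two_le_cast

theorem norm_ofReal_rpow (p : Nat.Primes) (σ : ℝ) :
    ‖((((p : ℕ) : ℝ) ^ σ : ℝ) : ℂ)‖ = ((p : ℕ) : ℝ) ^ σ := by
  rw [Complex.norm_real, Real.norm_of_nonneg (Real.rpow_nonneg p.cast_pos.le _)]

/-- Since `θ < 1/2 ≤ σ`, `p^(θ - σ) ≤ 2^(θ - 1/2) < 1`: one radius inside the unit disc serves all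
primes and all `σ`. -/
theorem LocalRootBound.norm_div_le (hα : LocalRootBound α θ) (hθ : θ < 1 / 2) (hσ : 1 / 2 ≤ σ)
    (j : Fin J) (p : Nat.Primes) (i : Fin d) :
    ‖α j p i / ((((p : ℕ) : ℝ) ^ σ : ℝ) : ℂ)‖ ≤ (2 : ℝ) ^ (θ - 1 / 2) := by
  have hp := p.cast_pos
  have hp2 := p.two_le_cast
  rw [norm_div, norm_ofReal_rpow, div_le_iff₀ (Real.rpow_pos_of_pos hp _)]
  calc ‖α j p i‖ ≤ ((p : ℕ) : ℝ) ^ θ := hα j p i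
    _ = ((p : ℕ) : ℝ) ^ (θ - 1 / 2) * ((p : ℕ) : ℝ) ^ (1 / 2 : ℝ) := by
      rw [← Real.rpow_add hp]; ring_nf
    _ ≤ (2 : ℝ) ^ (θ - 1 / 2) * ((p : ℕ) : ℝ) ^ σ := by
      gcongr ?_ * ?_
      · exact Real.rpow_le_rpow_of_nonpos (by norm_num) hp2 (by linarith)
      · exact Real.rpow_le_rpow_of_exponent_le (by linarith) hσ

theorem LocalRootBound.norm_mul_div_le (hα : LocalRootBound α θ) (hθ : θ < 1 / 2)
    (hσ : 1 / 2 ≤ σ) (j : Fin J) (p : Nat.Primes) (i : Fin d) {z : ℂ} (hz : ‖z‖ = 1) :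
    ‖α j p i * z / ((((p : ℕ) : ℝ) ^ σ : ℝ) : ℂ)‖ ≤ (2 : ℝ) ^ (θ - 1 / 2) := by
  rw [mul_div_right_comm, norm_mul, hz, mul_one]
  exact hα.norm_div_le hθ hσ j p i

theorem exp_localLog (hα : LocalRootBound α θ) (hθ : θ < 1 / 2) (hσ : 1 / 2 ≤ σ) (j : Fin J)
    (p : Nat.Primes) {z : ℂ} (hz : ‖z‖ = 1) :
    Complex.exp (localLog α σ j p z) =
      ∏ i, (1 - α j p i * z / ((((p : ℕ) : ℝ) ^ σ : ℝ) : ℂ))⁻¹ := by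
  rw [localLog, Complex.exp_sum]
  refine Finset.prod_congr rfl fun i _ => ?_
  rw [Complex.exp_neg, Complex.exp_log]
  exact one_sub_ne_zero_of_norm_le (hα.norm_mul_div_le hθ hσ j p i hz) (two_rpow_lt_one hθ)

theorem tsum_primePowerCoeff_eq_localLog (hα : LocalRootBound α θ) (hθ : θ < 1 / 2)
    (hσ : 1 / 2 ≤ σ) (j : Fin J) (p : Nat.Primes) {z : ℂ} (hz : ‖z‖ = 1) :
    ∑' k : ℕ, primePowerCoeff α j p (k + 1) * z ^ (k + 1) /
      ((((p : ℕ) : ℝ) ^ (((k + 1 : ℕ) : ℝ) * σ) : ℝ) : ℂ) = localLog α σ j p z := by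
  have h : ∀ i, HasSum (fun k : ℕ =>
      (α j p i * z / ((((p : ℕ) : ℝ) ^ σ : ℝ) : ℂ)) ^ (k + 1) / ((k + 1 : ℕ) : ℂ))
      (-Complex.log (1 - α j p i * z / ((((p : ℕ) : ℝ) ^ σ : ℝ) : ℂ))) := by
    intro i
    -- The Taylor series is indexed from `0`, where its term is `1 / 0 = 0`; the shift drops that
    -- term.
    have := (hasSum_nat_add_iff' 1).2 (Complex.hasSum_taylorSeries_neg_log
      ((hα.norm_mul_div_le hθ hσ j p i hz).trans_lt (two_rpow_lt_one hθ)))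
    simpa using this
  refine (HasSum.congr_fun (hasSum_sum fun i _ => h i) fun k => ?_).tsum_eq
  rw [primePowerCoeff, mul_comm (((k + 1 : ℕ) : ℝ)) σ, Real.rpow_mul p.cast_pos.le,
    Real.rpow_natCast, Finset.mul_sum, Finset.sum_mul, Finset.sum_div]
  refine Finset.sum_congr rfl fun i _ => ?_
  push_cast
  rw [div_pow, mul_pow]
  ring

variable {Ω : Type*} {X : Nat.Primes → Ω → ℂ} {ω : Ω}

theorem partialRandomLogL_eq_sum_localLog (hα : LocalRootBound α θ) (hθ : θ < 1 / 2)
    (hσ : 1 / 2 ≤ σ) (hX : ∀ p, ‖X p ω‖ = 1) (j : Fin J) (N : ℕ) :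
    partialRandomLogL α X σ j N ω = ∑ p ∈ primesUpTo N, localLog α σ j p (X p ω) :=
  Finset.sum_congr rfl fun p _ => tsum_primePowerCoeff_eq_localLog hα hθ hσ j p (hX p)

theorem exp_partialRandomLogL (hα : LocalRootBound α θ) (hθ : θ < 1 / 2)
    (hσ : 1 / 2 ≤ σ) (hX : ∀ p, ‖X p ω‖ = 1) (j : Fin J) (N : ℕ) :
    Complex.exp (partialRandomLogL α X σ j N ω) = partialRandomL α X σ j N ω := by
  rw [partialRandomLogL_eq_sum_localLog hα hθ hσ hX, Complex.exp_sum, partialRandomL]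
  exact Finset.prod_congr rfl fun p _ => exp_localLog hα hθ hσ j p (hX p)

theorem integral_unitCircleUniform {f : ℂ → ℂ} (hf : Measurable f) :
    ∫ z, f z ∂unitCircleUniform =
      (2 * Real.pi)⁻¹ • ∫ t in (0 : ℝ)..(2 * Real.pi), f (Complex.exp (t * Complex.I)) := by
  rw [unitCircleUniform, integral_map (by fun_prop) hf.aestronglyMeasurable,
    ← intervalIntegral.integral_of_le zero_le_one]
  have := intervalIntegral.integral_comp_mul_left (a := 0) (b := 1)
    (fun t : ℝ => f (Complex.exp (t * Complex.I))) (c := 2 * Real.pi) (by positivity)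
  rw [mul_zero, mul_one] at this
  rw [← this]
  push_cast
  rfl

theorem ae_norm_eq_one_unitCircleUniform : ∀ᵐ z ∂unitCircleUniform, ‖z‖ = 1 := by
  rw [unitCircleUniform, ae_map_iff (by fun_prop)
    (isClosed_eq continuous_norm continuous_const).measurableSet]
  refine Eventually.of_forall fun t => ?_
  have := Complex.norm_exp_ofReal_mul_I (2 * Real.pi * t)
  push_cast at this
  exact this

instance : IsProbabilityMeasure unitCircleUniform := by
  have : IsProbabilityMeasure ((volume : Measure ℝ).restrict (Set.Ioc 0 1)) :=
    ⟨by simp⟩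
  exact Measure.isProbabilityMeasure_map (by fun_prop)

/-- The constant in the decay of the local characteristic functions. -/
noncomputable def decayConst (n : ℕ) (ρ A : ℝ) : ℝ :=
  (1 + n * (2 / (1 - ρ) ^ 3)) * ((1 + 2 * (n * (2 / (1 - ρ) ^ 3))) / (A / 2) ^ 2)

/-- Decay of the local characteristic function in directions where the linear term of the local
logarithm dominates. -/
theorem norm_integral_cexp_localLog_le (hα : LocalRootBound α θ) (hθ : θ < 1 / 2)
    (hσ : 1 / 2 ≤ σ) {σ₀ : ℝ} (hσ₀ : σ ≤ σ₀) (p : Nat.Primes) {w : Fin J → ℂ}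
    (hw : ∀ j, ‖w j‖ ≤ 1) {A T : ℝ} (hA : 0 < A)
    (hA' : A ≤ ‖∑ j, w j * primePowerCoeff α j p 1‖ / ((p : ℕ) : ℝ) ^ σ₀)
    (hdom : 12 / (1 - (2 : ℝ) ^ (θ - 1 / 2)) ^ 2 *
      ((∑ j, ∑ i, ‖α j p i‖ ^ 2) / ((p : ℕ) : ℝ) ^ (1 / 2 : ℝ)) ≤
      ‖∑ j, w j * primePowerCoeff α j p 1‖) (hT : 1 ≤ T) :
    ‖∫ z, Complex.exp ((T * (∑ j, w j * localLog α σ j p z).re : ℝ) * Complex.I)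
      ∂unitCircleUniform‖ ≤ decayConst (J * d) ((2 : ℝ) ^ (θ - 1 / 2)) A / √T := by
  have hp := p.cast_pos
  have hp1 : (1 : ℝ) ≤ ((p : ℕ) : ℝ) := by linarith [p.two_le_cast]
  set P : ℝ := ((p : ℕ) : ℝ) ^ σ with hP
  have hP0 : 0 < P := Real.rpow_pos_of_pos hp _
  set c : Fin J × Fin d → ℂ := fun k => α k.1 p k.2 / (P : ℂ) with hc
  set v : Fin J × Fin d → ℂ := fun k => w k.1 with hv
  set m := ‖∑ j, w j * primePowerCoeff α j p 1‖ with hm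
  have hsum : ∑ k, v k * c k = (∑ j, w j * primePowerCoeff α j p 1) / (P : ℂ) := by
    simp only [hv, hc, Fintype.sum_prod_type, primePowerCoeff, Finset.sum_div, Finset.mul_sum]
    refine Finset.sum_congr rfl fun j _ => Finset.sum_congr rfl fun i _ => ?_
    simp only [Nat.cast_one, pow_one]
    ring
  have hnorm : ‖∑ k, v k * c k‖ = m / P := by
    rw [hsum, norm_div, Complex.norm_real, Real.norm_of_nonneg hP0.le]
  have hint := norm_integral_cexp_log_le (two_rpow_lt_one hθ)
    (c := c) (v := v) (A := A) (T := T) (fun k => hα.norm_div_le hθ hσ k.1 p k.2)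
    (fun k => hw k.1) hA ?_ ?_ hT
  · rw [integral_unitCircleUniform]
    · rw [norm_smul, norm_inv, Real.norm_of_nonneg (by positivity)]
      have e : ∀ t : ℝ, (∑ j, w j * localLog α σ j p (Complex.exp (t * Complex.I))) =
          ∑ k, v k * -Complex.log (1 - c k * Complex.exp (t * Complex.I)) := by
        intro t
        simp only [localLog, Fintype.sum_prod_type, hv, hc, Finset.mul_sum, ← hP,
          mul_div_right_comm]
      simp only [e]
      refine (mul_le_mul_of_nonneg_left hint (by positivity)).trans_eq ?_
      simp only [Fintype.card_prod, Fintype.card_fin]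
      rw [decayConst]
      have := Real.pi_pos
      field_simp
    · have := fun j => measurable_localLog α σ j p
      fun_prop
  -- The linear term decreases in `σ`, so its lower bound is taken at the right end `σ₀`.
  · rw [hnorm]
    refine hA'.trans ?_
    gcongr
    exact Real.rpow_le_rpow_of_exponent_le hp1 hσ₀
  -- The quadratic term carries one more factor `p^(-σ)` than the linear one, and this factor is
  -- largest at `σ = 1/2`.
  · rw [hnorm]
    have h1 : ∑ k, ‖c k‖ ^ 2 = (∑ j, ∑ i, ‖α j p i‖ ^ 2) / P / P := by
      simp only [hc, Fintype.sum_prod_type, Finset.sum_div, norm_div, Complex.norm_real,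
        Real.norm_of_nonneg hP0.le]
      refine Finset.sum_congr rfl fun j _ => Finset.sum_congr rfl fun i _ => ?_
      ring
    rw [h1, ← mul_div_assoc]
    gcongr
    refine le_trans ?_ hdom
    have : (0 : ℝ) ≤ ∑ j, ∑ i, ‖α j p i‖ ^ 2 := by positivity
    gcongr
    exact Real.rpow_le_rpow_of_exponent_le hp1 hσ

end LocalFactors

/-! ### Sums over primes: abundance of good primes in each direction. -/

section PrimeSums

variable {J d : ℕ} {α : Fin J → Nat.Primes → Fin d → ℂ} {θ : ℝ}

theorem sum_primesUpTo (f : ℕ → ℝ) (hf : ∀ n, ¬ n.Prime → f n = 0) (N : ℕ) :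
    ∑ p ∈ primesUpTo N, f p = ∑ n ∈ Finset.Icc 1 N, f n := by
  have h1 : ∑ p ∈ primesUpTo N, f p = ∑ n ∈ Finset.range (N + 1) with n.Prime, f n :=
    Finset.sum_subtype_eq_sum_filter f
  rw [h1]
  refine Finset.sum_subset_zero_on_sdiff ?_ ?_ fun _ _ => rfl
  · intro n hn
    simp only [Finset.mem_filter, Finset.mem_range] at hn
    exact Finset.mem_Icc.2 ⟨hn.2.one_lt.le, by omega⟩
  · intro n hn
    simp only [Finset.mem_sdiff, Finset.mem_Icc, Finset.mem_filter, Finset.mem_range] at hn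
    exact hf n fun hp => hn.2 ⟨by omega, hp⟩

/-- Partial summation, in the form of the L-series convergence criterion: with `δ = (s - 1)/2` the
partial sums grow with an exponent `1 + δ < s`. -/
theorem RamanujanOnAverage.summable (hRam : RamanujanOnAverage α) {s : ℝ} (hs : 1 < s)
    (j : Fin J) :
    Summable fun p : Nat.Primes => (∑ i, ‖α j p i‖ ^ 2) / ((p : ℕ) : ℝ) ^ s := by
  set f : ℕ → ℝ := fun n => if h : n.Prime then ∑ i, ‖α j ⟨n, h⟩ i‖ ^ 2 else 0 with hf
  have hfp : ∀ p : Nat.Primes, f p = ∑ i, ‖α j p i‖ ^ 2 := fun p => dif_pos p.2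
  have hO := (hRam ((s - 1) / 2) (by linarith) j).comp_tendsto tendsto_natCast_atTop_atTop
  have hO' : (fun n : ℕ => ∑ k ∈ Finset.Icc 1 n, f k) =O[atTop]
      fun n : ℕ => (n : ℝ) ^ (1 + (s - 1) / 2) := by
    refine hO.congr (fun n => ?_) fun n => rfl
    simp only [Function.comp, Nat.floor_natCast]
    rw [← sum_primesUpTo f fun n hn => dif_neg hn]
    exact Finset.sum_congr rfl fun p _ => (hfp p).symm
  have hL : LSeriesSummable (fun n => (f n : ℂ)) (s : ℂ) := by
    refine LSeriesSummable_of_sum_norm_bigO_and_nonneg hO' (fun n => ?_) (by linarith) ?_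
    · simp only [hf]; split_ifs <;> positivity
    · rw [Complex.ofReal_re]; linarith
  have hL' := (Summable.norm hL).comp_injective
    (Subtype.val_injective : Function.Injective fun p : Nat.Primes => (p : ℕ))
  refine hL'.congr fun (p : Nat.Primes) => ?_
  simp only [Function.comp]
  rw [LSeries.term_of_ne_zero p.2.ne_zero, norm_div, hfp, Complex.norm_real,
    Real.norm_of_nonneg (by positivity)]
  congr 1
  rw [← Complex.ofReal_natCast, ← Complex.ofReal_cpow p.cast_pos.le, norm_ofReal_rpow]

theorem norm_sq_sum_eq {β w : Fin J → ℂ} :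
    ((‖∑ j, w j * β j‖ ^ 2 : ℝ) : ℂ) =
      ∑ j, ∑ k, w j * (starRingEnd ℂ) (w k) * (β j * (starRingEnd ℂ) (β k)) := by
  rw [← Complex.normSq_eq_norm_sq, Complex.normSq_eq_conj_mul_self, map_sum, mul_comm,
    Finset.sum_mul_sum]
  refine Finset.sum_congr rfl fun j _ => Finset.sum_congr rfl fun k _ => ?_
  rw [map_mul]; ring

/-- Expanding the square gives a Hermitian form in the orthonormality sums. Off-diagonal terms stay
bounded, while the diagonal ones add up to `(∑ |w_j|² ξ_j) log log x`, which is unbounded. -/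
theorem SelbergOrthonormality.not_summable {ξ : Fin J → ℝ} {c : Fin J → Fin J → ℂ}
    (hSel : SelbergOrthonormality α ξ c) (hξ : ∀ j, 0 < ξ j) {w : Fin J → ℂ} (hw : w ≠ 0) :
    ¬ Summable fun p : Nat.Primes =>
      ‖∑ j, w j * primePowerCoeff α j p 1‖ ^ 2 / ((p : ℕ) : ℝ) := by
  intro hs
  set h : Nat.Primes → ℝ := fun p =>
    ‖∑ j, w j * primePowerCoeff α j p 1‖ ^ 2 / ((p : ℕ) : ℝ) with hh
  have hh0 : ∀ p, 0 ≤ h p := fun p => by positivity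
  set a : ℝ := ∑ j, ‖w j‖ ^ 2 * ξ j with ha
  have ha0 : 0 < a := by
    obtain ⟨j, hj⟩ := Function.ne_iff.1 hw
    refine Finset.sum_pos' (fun j _ => by have := hξ j; positivity) ⟨j, Finset.mem_univ _, ?_⟩
    have := hξ j
    have : 0 < ‖w j‖ := norm_pos_iff.2 hj
    positivity
  have hlog : Tendsto (fun x : ℝ => a * Real.log (Real.log x)) atTop atTop :=
    (Real.tendsto_log_atTop.comp Real.tendsto_log_atTop).const_mul_atTop ha0
  have hinv : (fun x : ℝ => 1 / Real.log x) =O[atTop] fun _ : ℝ => (1 : ℝ) := by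
    simp only [one_div]
    exact (Real.tendsto_log_atTop.inv_tendsto_atTop).isBigO_one ℝ
  have hE : (fun x : ℝ => ∑ j, ∑ k, w j * (starRingEnd ℂ) (w k) *
      ((∑ p ∈ primesUpTo ⌊x⌋₊,
        primePowerCoeff α j p 1 * (starRingEnd ℂ) (primePowerCoeff α k p 1) / ((p : ℕ) : ℂ))
      - ((if j = k then ((ξ j * Real.log (Real.log x) : ℝ) : ℂ) else 0) + c j k)))
      =O[atTop] fun _ : ℝ => (1 : ℝ) :=
    IsBigO.fun_sum fun j _ => IsBigO.fun_sum fun k _ =>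
      ((hSel j k).trans hinv).const_mul_left _
  set C : ℂ := ∑ j, ∑ k, w j * (starRingEnd ℂ) (w k) * c j k with hC
  have hEq : ∀ x : ℝ, (∑ j, ∑ k, w j * (starRingEnd ℂ) (w k) *
      ((∑ p ∈ primesUpTo ⌊x⌋₊,
        primePowerCoeff α j p 1 * (starRingEnd ℂ) (primePowerCoeff α k p 1) / ((p : ℕ) : ℂ))
      - ((if j = k then ((ξ j * Real.log (Real.log x) : ℝ) : ℂ) else 0) + c j k))) =
      ((∑ p ∈ primesUpTo ⌊x⌋₊, h p : ℝ) : ℂ) - ((a * Real.log (Real.log x) : ℝ) : ℂ) - C := by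
    intro x
    have e1 : ((∑ p ∈ primesUpTo ⌊x⌋₊, h p : ℝ) : ℂ) =
        ∑ j, ∑ k, w j * (starRingEnd ℂ) (w k) * (∑ p ∈ primesUpTo ⌊x⌋₊,
        primePowerCoeff α j p 1 * (starRingEnd ℂ) (primePowerCoeff α k p 1) /
          ((p : ℕ) : ℂ)) := by
      have : ∀ p, (h p : ℂ) = ∑ j, ∑ k, w j * (starRingEnd ℂ) (w k) *
          (primePowerCoeff α j p 1 * (starRingEnd ℂ) (primePowerCoeff α k p 1) /
          ((p : ℕ) : ℂ)) := by
        intro p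
        simp only [hh]
        rw [Complex.ofReal_div, norm_sq_sum_eq, Finset.sum_div]
        refine Finset.sum_congr rfl fun j _ => ?_
        rw [Finset.sum_div]
        refine Finset.sum_congr rfl fun k _ => ?_
        rw [Complex.ofReal_natCast, mul_div_assoc]
      rw [Complex.ofReal_sum, Finset.sum_congr rfl fun p _ => this p, Finset.sum_comm]
      refine Finset.sum_congr rfl fun j _ => ?_
      rw [Finset.sum_comm]
      refine Finset.sum_congr rfl fun k _ => ?_
      rw [Finset.mul_sum]
    have e2 : ((a * Real.log (Real.log x) : ℝ) : ℂ) = ∑ j, ∑ k, w j * (starRingEnd ℂ) (w k) *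
        (if j = k then ((ξ j * Real.log (Real.log x) : ℝ) : ℂ) else 0) := by
      rw [ha, Finset.sum_mul, Complex.ofReal_sum]
      refine Finset.sum_congr rfl fun j _ => ?_
      simp only [mul_ite, mul_zero, Finset.sum_ite_eq, Finset.mem_univ, if_true]
      rw [Complex.mul_conj, Complex.normSq_eq_norm_sq]
      push_cast
      ring
    rw [e1, e2, hC]
    simp only [mul_sub, mul_add, Finset.sum_sub_distrib, Finset.sum_add_distrib]
    ring
  simp only [hEq] at hE
  obtain ⟨B, hB⟩ := hE.bound
  have hev := (hlog.eventually_gt_atTop (∑' p, h p + B + ‖C‖)).and hB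
  obtain ⟨x, hx1, hx2⟩ := hev.exists
  have hle : ∑ p ∈ primesUpTo ⌊x⌋₊, h p ≤ ∑' p, h p := hs.sum_le_tsum _ fun p _ => hh0 p
  rw [norm_one, mul_one] at hx2
  have h3 := norm_sub_norm_le
    (((∑ p ∈ primesUpTo ⌊x⌋₊, h p : ℝ) : ℂ) - ((a * Real.log (Real.log x) : ℝ) : ℂ)) C
  rw [← Complex.ofReal_sub, Complex.norm_real, Real.norm_eq_abs, abs_sub_comm] at h3
  have h4 := le_abs_self (a * Real.log (Real.log x) - ∑ p ∈ primesUpTo ⌊x⌋₊, h p)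
  rw [← Complex.ofReal_sub] at hx2
  linarith

/-- In every direction there are infinitely many primes at which the linear term of the local
logarithm dominates the terms of higher order. -/
theorem infinite_setOf_lt_norm_sum_mul_primePowerCoeff (hθ : θ < 1 / 2)
    (hα : LocalRootBound α θ) (hRam : RamanujanOnAverage α) {ξ : Fin J → ℝ}
    {c : Fin J → Fin J → ℂ} (hSel : SelbergOrthonormality α ξ c) (hξ : ∀ j, 0 < ξ j)
    {w : Fin J → ℂ} (hw : w ≠ 0) (κ : ℝ) :
    {p : Nat.Primes | κ * ((∑ j, ∑ i, ‖α j p i‖ ^ 2) / ((p : ℕ) : ℝ) ^ (1 / 2 : ℝ)) <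
      ‖∑ j, w j * primePowerCoeff α j p 1‖}.Infinite := by
  intro hfin
  refine hSel.not_summable hξ hw ?_
  -- At a bad prime `|∑ w_j β_j(p)|² / p ≤ κ² S² / p²`. Bounding one factor `S` by `J d p^(2θ)`
  -- leaves `S / p^(2 - 2θ)`, summable since `2 - 2θ > 1`.
  have hsum : Summable fun p : Nat.Primes => κ ^ 2 * (J * d) *
      ∑ j, (∑ i, ‖α j p i‖ ^ 2) / ((p : ℕ) : ℝ) ^ (2 - 2 * θ) :=
    (summable_sum fun j _ => hRam.summable (by linarith) j).mul_left _
  refine Summable.of_norm_bounded_eventually hsum ?_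
  filter_upwards [hfin.compl_mem_cofinite] with p hp
  simp only [Set.mem_compl_iff, Set.mem_ofPred_eq, not_lt] at hp
  have hp0 := p.cast_pos
  set Q : ℝ := ((p : ℕ) : ℝ) with hQ
  set S : ℝ := ∑ j, ∑ i, ‖α j p i‖ ^ 2 with hS
  have hS0 : 0 ≤ S := by positivity
  have hSle : S ≤ J * d * Q ^ (2 * θ) := by
    calc S ≤ ∑ j : Fin J, ∑ i : Fin d, Q ^ (2 * θ) := by
          refine Finset.sum_le_sum fun j _ => Finset.sum_le_sum fun i _ => ?_
          rw [mul_comm, Real.rpow_mul hp0.le, Real.rpow_two]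
          gcongr
          exact hα j p i
      _ = _ := by simp; ring
  rw [Real.norm_of_nonneg (by positivity), ← Finset.sum_div]
  have hroot : (Q ^ (1 / 2 : ℝ)) ^ 2 = Q := by
    rw [← Real.rpow_natCast, ← Real.rpow_mul hp0.le]; norm_num
  calc ‖∑ j, w j * primePowerCoeff α j p 1‖ ^ 2 / Q
      ≤ (κ * (S / Q ^ (1 / 2 : ℝ))) ^ 2 / Q := by gcongr
    _ = κ ^ 2 * (S * S) / (Q * Q) := by
        rw [mul_pow, div_pow, hroot]; field_simp
    _ ≤ κ ^ 2 * (J * d * Q ^ (2 * θ) * S) / (Q * Q) := by gcongr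
    _ = κ ^ 2 * (J * d) * (S / Q ^ (2 - 2 * θ)) := by
        rw [Real.rpow_sub hp0, Real.rpow_two]
        have : Q ^ (2 * θ) ≠ 0 := (Real.rpow_pos_of_pos hp0 _).ne'
        field_simp

end PrimeSums

/-- The strict inequality is open, so `n` indices good at `x` stay good near `x`. Finitely many
neighbourhoods suffice, and their index sets are united; the selected subset still varies with `x`.
-/
theorem IsCompact.exists_finset_forall_exists_subset {ι E : Type*} [TopologicalSpace E]
    {K : Set E} (hK : IsCompact K) {f : ι → E → ℝ} (hf : ∀ i, Continuous (f i)) {a : ι → ℝ}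
    (ha : ∀ i, 0 ≤ a i) (hinf : ∀ x ∈ K, {i | a i < f i x}.Infinite) (n : ℕ) :
    ∃ S : Finset ι, ∃ m : ℝ, 0 < m ∧ ∀ x ∈ K, ∃ S' ⊆ S, S'.card = n ∧
      ∀ i ∈ S', a i ≤ f i x ∧ m ≤ f i x := by
  classical
  refine hK.induction_on (p := fun K => ∃ S : Finset ι, ∃ m : ℝ, 0 < m ∧ ∀ x ∈ K, ∃ S' ⊆ S,
    S'.card = n ∧ ∀ i ∈ S', a i ≤ f i x ∧ m ≤ f i x) ?_ ?_ ?_ ?_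
  · exact ⟨∅, 1, one_pos, fun x hx => absurd hx (Set.notMem_empty x)⟩
  · rintro s t hst ⟨S, m, hm, h⟩
    exact ⟨S, m, hm, fun x hx => h x (hst hx)⟩
  · rintro s t ⟨S, m, hm, h⟩ ⟨S₂, m₂, hm₂, h₂⟩
    refine ⟨S ∪ S₂, min m m₂, lt_min hm hm₂, ?_⟩
    rintro x (hx | hx)
    · obtain ⟨S', hS', hc, hi⟩ := h x hx
      exact ⟨S', hS'.trans Finset.subset_union_left, hc,
        fun i hi' => ⟨(hi i hi').1, (min_le_left _ _).trans (hi i hi').2⟩⟩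
    · obtain ⟨S', hS', hc, hi⟩ := h₂ x hx
      exact ⟨S', hS'.trans Finset.subset_union_right, hc,
        fun i hi' => ⟨(hi i hi').1, (min_le_right _ _).trans (hi i hi').2⟩⟩
  · intro x hx
    obtain ⟨S', hS', hc⟩ := (hinf x hx).exists_subset_card_eq n
    have hpos : ∀ i ∈ S', 0 < f i x := fun i hi => (ha i).trans_lt (hS' hi)
    have hm : ∀ᶠ m : ℝ in 𝓝[>] 0, ∀ i ∈ S', m < f i x := by
      rw [Filter.eventually_all_finset]
      exact fun i hi => nhdsWithin_le_nhds (eventually_lt_nhds (hpos i hi))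
    obtain ⟨m, hm1, hm0⟩ := (hm.and self_mem_nhdsWithin).exists
    refine ⟨{y | ∀ i ∈ S', a i < f i y ∧ m < f i y}, mem_nhdsWithin_of_mem_nhds ?_, S', m, hm0,
      fun y hy => ⟨S', subset_rfl, hc, fun i hi => ⟨(hy i hi).1.le, (hy i hi).2.le⟩⟩⟩
    have : ∀ᶠ y in 𝓝 x, ∀ i ∈ S', a i < f i y ∧ m < f i y := by
      rw [Filter.eventually_all_finset]
      exact fun i hi => ((hf i).continuousAt.eventually (eventually_gt_nhds (hS' hi))).and
        ((hf i).continuousAt.eventually (eventually_gt_nhds (hm1 i hi)))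
    exact this

/-! ### Almost sure convergence of random series over primes. -/

section RandomSeries

variable {Ω : Type*} [mΩ : MeasurableSpace Ω] {P : Measure Ω}

/-- Kolmogorov's one-series theorem. -/
theorem ae_exists_tendsto_sum_of_summable_integral_sq {Y : ℕ → Ω → ℝ}
    (hY : ∀ n, Measurable (Y n)) (hL2 : ∀ n, MemLp (Y n) 2 P) (hind : iIndepFun Y P)
    (hmean : ∀ n, ∫ ω, Y n ω ∂P = 0) (hsum : Summable fun n => ∫ ω, Y n ω ^ 2 ∂P) :
    ∀ᵐ ω ∂P, ∃ l, Tendsto (fun N => ∑ n ∈ Finset.range N, Y n ω) atTop (𝓝 l) := by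
  have hprob : IsProbabilityMeasure P := hind.isProbabilityMeasure
  have hsm : ∀ n, StronglyMeasurable (Y n) := fun n => (hY n).stronglyMeasurable
  set ℱ := Filtration.natural Y hsm with hℱ
  -- The sum includes `Y n`, matching `ℱ n`, which already knows `Y n`. Orthogonality makes this
  -- martingale bounded in `L²`, hence in `L¹`, and Doob's convergence theorem applies.
  set S : ℕ → Ω → ℝ := fun n => ∑ i ∈ Finset.range (n + 1), Y i with hS
  have hint : ∀ n, Integrable (Y n) P := fun n => (hL2 n).integrable (by norm_num)
  have hSint : ∀ n, Integrable (S n) P := fun n => integrable_finsetSum' _ fun i _ => hint i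
  have hadY : ∀ i n, i ≤ n → StronglyMeasurable[ℱ n] (Y i) := fun i n hin =>
    (Filtration.stronglyAdapted_natural hsm i).mono (ℱ.mono hin)
  have hmart : Martingale S ℱ P := by
    refine martingale_nat (fun n => ?_) hSint fun n => ?_
    · exact Finset.stronglyMeasurable_sum _ fun i hi =>
        hadY i n (Nat.lt_succ_iff.1 (Finset.mem_range.1 hi))
    · have h1 : S (n + 1) = S n + Y (n + 1) := Finset.sum_range_succ _ _
      have h2 : P[S n | ℱ n] = S n := condExp_of_stronglyMeasurable (ℱ.le n)
        (Finset.stronglyMeasurable_sum _ fun i hi =>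
          hadY i n (Nat.lt_succ_iff.1 (Finset.mem_range.1 hi))) (hSint n)
      have h3 := hind.condExp_natural_ae_eq_of_lt hsm (Nat.lt_succ_self n)
      rw [h1]
      filter_upwards [condExp_add (hSint n) (hint (n + 1)) (ℱ n), h3] with ω hω hω'
      rw [hω, Pi.add_apply, h2, hω', hmean, add_zero]
  have hSL2 : ∀ n, MemLp (S n) 2 P := fun n => memLp_finsetSum' _ fun i _ => hL2 i
  have hSmean : ∀ n, ∫ ω, S n ω ∂P = 0 := by
    intro n
    simp only [hS, Finset.sum_apply]
    rw [integral_finsetSum _ fun i _ => hint i]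
    simp [hmean]
  set B : ℝ := ∑' n, ∫ ω, Y n ω ^ 2 ∂P with hB
  have hvar : ∀ n, ∫ ω, S n ω ^ 2 ∂P ≤ B := by
    intro n
    have h1 : Var[S n; P] = ∫ ω, S n ω ^ 2 ∂P :=
      variance_of_integral_eq_zero (hSL2 n).aemeasurable (hSmean n)
    have h2 : Var[S n; P] = ∑ i ∈ Finset.range (n + 1), Var[Y i; P] :=
      IndepFun.variance_sum (fun i _ => hL2 i) fun i _ j _ hij => hind.indepFun hij
    rw [← h1, h2]
    have h3 : ∀ i, Var[Y i; P] = ∫ ω, Y i ω ^ 2 ∂P := fun i =>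
      variance_of_integral_eq_zero (hY i).aemeasurable (hmean i)
    simp only [h3]
    exact hsum.sum_le_tsum _ fun i _ => integral_nonneg fun ω => sq_nonneg _
  have hbdd : ∀ n, eLpNorm (S n) 1 P ≤ ((B + 1).toNNReal : ENNReal) := by
    intro n
    rw [eLpNorm_one_eq_lintegral_enorm, ← ofReal_integral_norm_eq_lintegral_enorm (hSint n)]
    refine ENNReal.ofReal_le_ofReal ?_
    calc ∫ ω, ‖S n ω‖ ∂P ≤ ∫ ω, (S n ω ^ 2 + 1) ∂P := by
          refine integral_mono (hSint n).norm ((hSL2 n).integrable_sq.add (integrable_const _))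
            fun ω => ?_
          simp only [Real.norm_eq_abs]
          nlinarith [sq_abs (S n ω), sq_nonneg (|S n ω| - 1), sq_nonneg (|S n ω|)]
      _ = ∫ ω, S n ω ^ 2 ∂P + 1 := by
          rw [integral_add (hSL2 n).integrable_sq (integrable_const _)]
          simp
      _ ≤ B + 1 := by linarith [hvar n]
  filter_upwards [hmart.submartingale.exists_ae_tendsto_of_bdd hbdd] with ω ⟨l, hl⟩
  refine ⟨l, (tendsto_add_atTop_iff_nat 1).1 ?_⟩
  simpa [hS] using hl

/-- The increasing enumeration of the primes. -/
noncomputable def nthPrime (n : ℕ) : Nat.Primes := ⟨Nat.nth Nat.Prime n, Nat.prime_nth_prime n⟩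

theorem nthPrime_injective : Function.Injective nthPrime := fun _ _ h =>
  Nat.nth_injective Nat.infinite_setOfPred_prime (congrArg Subtype.val h)

theorem mem_primesUpTo {N : ℕ} {p : Nat.Primes} : p ∈ primesUpTo N ↔ (p : ℕ) ≤ N := by
  rw [primesUpTo]
  exact Finset.mem_subtype.trans (Finset.mem_range.trans Nat.lt_succ_iff)

/-- The random series need not converge absolutely, so the martingale argument must follow the
primes in increasing order. -/
theorem sum_primesUpTo_eq_sum_range {E : Type*} [AddCommMonoid E] (f : Nat.Primes → E) (N : ℕ) :
    ∑ p ∈ primesUpTo N, f p = ∑ n ∈ Finset.range (Nat.primeCounting N), f (nthPrime n) := by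
  symm
  refine Finset.sum_bij (fun n _ => nthPrime n) ?_ ?_ ?_ fun _ _ => rfl
  · intro n hn
    rw [mem_primesUpTo]
    exact Nat.lt_succ_iff.1 (Nat.nth_lt_of_lt_count (Finset.mem_range.1 hn))
  · exact fun a _ b _ h => nthPrime_injective h
  · intro p hp
    rw [mem_primesUpTo] at hp
    refine ⟨Nat.count Nat.Prime p, Finset.mem_range.2 ?_, Subtype.ext (Nat.nth_count p.2)⟩
    exact Nat.count_strict_mono p.2 (Nat.lt_succ_iff.2 hp)

theorem tendsto_primesUpTo : Tendsto primesUpTo atTop atTop :=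
  tendsto_atTop_finset_of_monotone
    (fun _ _ h _ hp => mem_primesUpTo.2 ((mem_primesUpTo.1 hp).trans h))
    fun p => ⟨p, mem_primesUpTo.2 le_rfl⟩

variable {X : Nat.Primes → Ω → ℂ}

theorem integral_id_unitCircleUniform : ∫ z, z ∂unitCircleUniform = 0 := by
  rw [integral_unitCircleUniform (f := fun z => z) measurable_id]
  have : ∫ t in (0 : ℝ)..(2 * Real.pi), Complex.exp (t * Complex.I) = 0 := by
    have h := integral_exp_mul_complex (a := 0) (b := 2 * Real.pi) Complex.I_ne_zero
    simp only [mul_comm Complex.I] at h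
    rw [h]
    simp [Complex.exp_two_pi_mul_I]
  simp [this]

theorem IsRandomUnitSequence.ae_norm_eq_one (hX : IsRandomUnitSequence P X) :
    ∀ᵐ ω ∂P, ∀ p, ‖X p ω‖ = 1 := by
  rw [ae_all_iff]
  intro p
  have h := ae_norm_eq_one_unitCircleUniform
  rw [← (hX.law p).map_eq] at h
  exact ae_of_ae_map (hX.law p).aemeasurable h

theorem IsRandomUnitSequence.integral_comp (hX : IsRandomUnitSequence P X) (p : Nat.Primes)
    {f : ℂ → ℂ} (hf : Measurable f) :
    ∫ ω, f (X p ω) ∂P = ∫ z, f z ∂unitCircleUniform := by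
  rw [← (hX.law p).map_eq, integral_map (hX.law p).aemeasurable hf.aestronglyMeasurable]

/-- `HasLaw` provides only a.e. measurability, whereas the natural filtration needs measurable
variables. Modifying countably many of them costs one null set. -/
theorem IsRandomUnitSequence.exists_measurable (hX : IsRandomUnitSequence P X) :
    ∃ X' : Nat.Primes → Ω → ℂ, (∀ p, Measurable (X' p)) ∧ IsRandomUnitSequence P X' ∧
      ∀ᵐ ω ∂P, ∀ p, X p ω = X' p ω := by
  refine ⟨fun p => (hX.law p).aemeasurable.mk, fun p => (hX.law p).aemeasurable.measurable_mk,
    ⟨hX.indep.congr fun p => (hX.law p).aemeasurable.ae_eq_mk, fun p => ⟨?_, ?_⟩⟩,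
    ae_all_iff.2 fun p => (hX.law p).aemeasurable.ae_eq_mk⟩
  · exact (hX.law p).aemeasurable.measurable_mk.aemeasurable
  · exact (Measure.map_congr (hX.law p).aemeasurable.ae_eq_mk).symm.trans (hX.law p).map_eq

theorem IsRandomUnitSequence.ae_exists_tendsto_sum_re_of_measurable
    (hX : IsRandomUnitSequence P X) (hXm : ∀ p, Measurable (X p)) {c : Nat.Primes → ℂ}
    (hc : Summable fun p => ‖c p‖ ^ 2) :
    ∀ᵐ ω ∂P, ∃ l, Tendsto (fun N => ∑ p ∈ primesUpTo N, (c p * X p ω).re) atTop (𝓝 l) := by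
  have hprob : IsProbabilityMeasure P := hX.indep.isProbabilityMeasure
  set Y : ℕ → Ω → ℝ := fun n ω => (c (nthPrime n) * X (nthPrime n) ω).re with hYdef
  have hYm : ∀ n, Measurable (Y n) := fun n => by
    have := hXm (nthPrime n)
    fun_prop
  have hYb : ∀ n, ∀ᵐ ω ∂P, ‖Y n ω‖ ≤ ‖c (nthPrime n)‖ := by
    intro n
    filter_upwards [hX.ae_norm_eq_one] with ω hω
    refine (Complex.abs_re_le_norm _).trans ?_
    rw [norm_mul, hω, mul_one]
  have hL2 : ∀ n, MemLp (Y n) 2 P := fun n =>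
    MemLp.of_bound (hYm n).aestronglyMeasurable _ (hYb n)
  have hind : iIndepFun Y P :=
    (hX.indep.precomp nthPrime_injective).comp (fun n z => (c (nthPrime n) * z).re)
      fun n => by fun_prop
  have hmean : ∀ n, ∫ ω, Y n ω ∂P = 0 := by
    intro n
    have h1 : Integrable (fun ω => c (nthPrime n) * X (nthPrime n) ω) P := by
      refine Integrable.of_bound (C := ‖c (nthPrime n)‖) ?_ ?_
      · have := hXm (nthPrime n)
        exact (by fun_prop : Measurable _).aestronglyMeasurable
      · filter_upwards [hX.ae_norm_eq_one] with ω hω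
        rw [norm_mul, hω, mul_one]
    have h2 := integral_re h1
    have h3 : ∫ ω, c (nthPrime n) * X (nthPrime n) ω ∂P = 0 := by
      rw [integral_const_mul, hX.integral_comp (nthPrime n) (f := fun z => z) measurable_id,
        integral_id_unitCircleUniform, mul_zero]
    rw [h3] at h2
    exact h2.trans Complex.zero_re
  have hsum : Summable fun n => ∫ ω, Y n ω ^ 2 ∂P := by
    refine Summable.of_nonneg_of_le (fun n => integral_nonneg fun ω => sq_nonneg _) (fun n => ?_)
      (hc.comp_injective nthPrime_injective)
    calc ∫ ω, Y n ω ^ 2 ∂P ≤ ∫ _, ‖c (nthPrime n)‖ ^ 2 ∂P := by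
          refine integral_mono_ae (hL2 n).integrable_sq (integrable_const _) ?_
          filter_upwards [hYb n] with ω hω
          rw [Real.norm_eq_abs] at hω
          rw [← sq_abs]
          gcongr
      _ = _ := by simp
  filter_upwards [ae_exists_tendsto_sum_of_summable_integral_sq hYm hL2 hind hmean hsum]
    with ω ⟨l, hl⟩
  refine ⟨l, (hl.comp Nat.tendsto_primeCounting).congr fun N => ?_⟩
  rw [sum_primesUpTo_eq_sum_range]
  rfl

theorem IsRandomUnitSequence.ae_exists_tendsto_sum (hX : IsRandomUnitSequence P X)
    {c : Nat.Primes → ℂ} (hc : Summable fun p => ‖c p‖ ^ 2) :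
    ∀ᵐ ω ∂P, ∃ l, Tendsto (fun N => ∑ p ∈ primesUpTo N, c p * X p ω) atTop (𝓝 l) := by
  obtain ⟨X', hm, hX', hXX'⟩ := hX.exists_measurable
  -- Imaginary parts, via `Im z = Re (-i z)`.
  have h2 := hX'.ae_exists_tendsto_sum_re_of_measurable hm (c := fun p => -Complex.I * c p)
    (by simpa using hc)
  filter_upwards [hX'.ae_exists_tendsto_sum_re_of_measurable hm hc, h2, hXX']
    with ω ⟨l₁, hl₁⟩ ⟨l₂, hl₂⟩ hω
  refine ⟨l₁ + l₂ * Complex.I, ?_⟩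
  have h := ((Complex.continuous_ofReal.tendsto _).comp hl₁).add
    (((Complex.continuous_ofReal.tendsto _).comp hl₂).mul_const Complex.I)
  refine h.congr fun N => ?_
  simp only [Function.comp, Complex.ofReal_sum, Finset.sum_mul, ← Finset.sum_add_distrib, hω]
  refine Finset.sum_congr rfl fun p _ => ?_
  apply Complex.ext <;> simp

end RandomSeries

/-! ### Convergence of the random Euler products. -/

section Convergence

variable {J d : ℕ} {α : Fin J → Nat.Primes → Fin d → ℂ} {θ σ : ℝ}
  {Ω : Type*} [MeasurableSpace Ω] {P : Measure Ω} {X : Nat.Primes → Ω → ℂ}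

theorem norm_neg_log_one_sub_sub_le {u : ℂ} {ρ : ℝ} (hu : ‖u‖ ≤ ρ) (hρ : ρ < 1) :
    ‖-Complex.log (1 - u) - u‖ ≤ (1 - ρ)⁻¹ * ‖u‖ ^ 2 := by
  have h := Complex.norm_log_one_add_sub_self_le (z := -u) (by rw [norm_neg]; linarith)
  rw [norm_neg] at h
  have e : ‖-Complex.log (1 - u) - u‖ = ‖Complex.log (1 + -u) - -u‖ := by
    rw [← norm_neg]; congr 1; ring_nf
  rw [e]
  refine h.trans ?_
  have h1 : (1 - ‖u‖)⁻¹ ≤ (1 - ρ)⁻¹ := inv_anti₀ (by linarith) (by linarith)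
  have h2 : 0 ≤ (1 - ρ)⁻¹ := inv_nonneg.2 (by linarith)
  have h3 : ‖u‖ ^ 2 * (1 - ‖u‖)⁻¹ ≤ ‖u‖ ^ 2 * (1 - ρ)⁻¹ := by gcongr
  nlinarith [sq_nonneg ‖u‖, mul_nonneg (sq_nonneg ‖u‖) h2]

theorem norm_localLog_sub_le (hα : LocalRootBound α θ) (hθ : θ < 1 / 2) (hσ : 1 / 2 ≤ σ)
    (j : Fin J) (p : Nat.Primes) {z : ℂ} (hz : ‖z‖ = 1) :
    ‖localLog α σ j p z - primePowerCoeff α j p 1 / ((((p : ℕ) : ℝ) ^ σ : ℝ) : ℂ) * z‖ ≤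
      (1 - (2 : ℝ) ^ (θ - 1 / 2))⁻¹ *
        ((∑ i, ‖α j p i‖ ^ 2) / ((p : ℕ) : ℝ) ^ (2 * σ)) := by
  have e : primePowerCoeff α j p 1 / ((((p : ℕ) : ℝ) ^ σ : ℝ) : ℂ) * z =
      ∑ i, α j p i * z / ((((p : ℕ) : ℝ) ^ σ : ℝ) : ℂ) := by
    simp only [primePowerCoeff, Nat.cast_one, div_one, one_mul, pow_one, Finset.sum_div,
      Finset.sum_mul, mul_div_right_comm]
  rw [e, localLog, ← Finset.sum_sub_distrib, Finset.sum_div, Finset.mul_sum]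
  refine (norm_sum_le _ _).trans (Finset.sum_le_sum fun i _ => ?_)
  refine (norm_neg_log_one_sub_sub_le (hα.norm_mul_div_le hθ hσ j p i hz)
    (two_rpow_lt_one hθ)).trans_eq ?_
  rw [norm_div, norm_mul, hz, mul_one, norm_ofReal_rpow, div_pow, mul_comm 2 σ,
    Real.rpow_mul p.cast_pos.le, Real.rpow_two]

/-- The linear terms converge almost surely because their coefficients are square summable for `2σ >
1`; the remainders are quadratic in the roots and converge absolutely. -/
theorem ae_exists_tendsto_partialRandomLogL (hα : LocalRootBound α θ) (hθ : θ < 1 / 2)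
    (hRam : RamanujanOnAverage α) (hX : IsRandomUnitSequence P X) (hσ : 1 / 2 < σ) (j : Fin J) :
    ∀ᵐ ω ∂P, ∃ l, Tendsto (fun N => partialRandomLogL α X σ j N ω) atTop (𝓝 l) := by
  set c : Nat.Primes → ℂ := fun p =>
    primePowerCoeff α j p 1 / ((((p : ℕ) : ℝ) ^ σ : ℝ) : ℂ) with hc
  have hs := hRam.summable (s := 2 * σ) (by linarith) j
  have hcs : Summable fun p => ‖c p‖ ^ 2 := by
    refine Summable.of_nonneg_of_le (fun p => by positivity) (fun p => ?_) (hs.mul_left (d : ℝ))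
    rw [hc]
    simp only [norm_div, norm_ofReal_rpow, div_pow, primePowerCoeff, Nat.cast_one, div_one,
      one_mul, pow_one]
    rw [mul_comm 2 σ, Real.rpow_mul p.cast_pos.le, Real.rpow_two, ← mul_div_assoc]
    gcongr
    calc ‖∑ i, α j p i‖ ^ 2 ≤ (∑ i, ‖α j p i‖) ^ 2 := by gcongr; exact norm_sum_le _ _
      _ ≤ d * ∑ i, ‖α j p i‖ ^ 2 := by
        simpa using sq_sum_le_card_mul_sum_sq (s := Finset.univ) (f := fun i => ‖α j p i‖)
  filter_upwards [hX.ae_exists_tendsto_sum hcs, hX.ae_norm_eq_one] with ω ⟨l, hl⟩ hω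
  have hrest : Summable fun p => localLog α σ j p (X p ω) - c p * X p ω :=
    Summable.of_norm_bounded (hs.mul_left _) fun p =>
      norm_localLog_sub_le hα hθ hσ.le j p (hω p)
  refine ⟨l + ∑' p, (localLog α σ j p (X p ω) - c p * X p ω), ?_⟩
  refine (hl.add (hrest.hasSum.comp tendsto_primesUpTo)).congr fun N => ?_
  rw [partialRandomLogL_eq_sum_localLog hα hθ hσ.le hω, Function.comp,
    ← Finset.sum_add_distrib]
  exact Finset.sum_congr rfl fun p _ => by ring

theorem ae_tendsto_randomL (hα : LocalRootBound α θ) (hθ : θ < 1 / 2)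
    (hRam : RamanujanOnAverage α) (hX : IsRandomUnitSequence P X) (hσ : 1 / 2 < σ) :
    ∀ᵐ ω ∂P, ∀ j,
      Tendsto (fun N => partialRandomL α X σ j N ω) atTop (𝓝 (randomL α X σ j ω)) ∧
      Tendsto (fun N => partialRandomLogL α X σ j N ω) atTop (𝓝 (randomLogL α X σ j ω)) ∧
      Complex.exp (randomLogL α X σ j ω) = randomL α X σ j ω := by
  filter_upwards [ae_all_iff.2 fun j => ae_exists_tendsto_partialRandomLogL hα hθ hRam hX hσ j,
    hX.ae_norm_eq_one] with ω hω hω1 j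
  have h1 : Tendsto (fun N => partialRandomLogL α X σ j N ω) atTop (𝓝 (randomLogL α X σ j ω)) :=
    tendsto_nhds_limUnder (hω j)
  have h2 : Tendsto (fun N => partialRandomL α X σ j N ω) atTop
      (𝓝 (Complex.exp (randomLogL α X σ j ω))) :=
    ((Complex.continuous_exp.tendsto _).comp h1).congr fun N =>
      exp_partialRandomLogL hα hθ hσ.le hω1 j N
  have h3 : randomL α X σ j ω = Complex.exp (randomLogL α X σ j ω) := h2.limUnder_eq
  exact ⟨h3 ▸ h2, h1, h3.symm⟩

end Convergence

/-! ### Uniform polynomial decay of products of local characteristic functions. -/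

section Decay

variable {J d : ℕ} {α : Fin J → Nat.Primes → Fin d → ℂ} {θ σ : ℝ}

/-- The characteristic function of the vector of logarithms of the local factors at `p`. -/
noncomputable def localCharFun (α : Fin J → Nat.Primes → Fin d → ℂ) (σ : ℝ) (p : Nat.Primes)
    (t : Fin J → ℂ) : ℂ :=
  ∫ z, Complex.exp (((∑ j, (starRingEnd ℂ) (t j) * localLog α σ j p z).re : ℝ) * Complex.I)
    ∂unitCircleUniform

theorem norm_localCharFun_le_one (p : Nat.Primes) (t : Fin J → ℂ) :
    ‖localCharFun α σ p t‖ ≤ 1 := by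
  refine (norm_integral_le_of_norm_le_const (C := 1) (Eventually.of_forall fun z => ?_)).trans ?_
  · rw [Complex.norm_exp_ofReal_mul_I]
  · simp

/-- Compactness is applied to the unit sphere of directions, and `‖t‖` becomes the large parameter
of the oscillatory integral. Finiteness of `S` is what makes `D` uniform. -/
theorem exists_finset_norm_localCharFun_le (hα : LocalRootBound α θ) (hθ : θ < 1 / 2)
    (hRam : RamanujanOnAverage α) {ξ : Fin J → ℝ} {c : Fin J → Fin J → ℂ}
    (hSel : SelbergOrthonormality α ξ c) (hξ : ∀ j, 0 < ξ j) (σ₀ : ℝ) (n : ℕ) :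
    ∃ S : Finset Nat.Primes, ∃ D : ℝ, ∀ σ, 1 / 2 ≤ σ → σ ≤ σ₀ →
      ∀ t : EuclideanSpace ℂ (Fin J), 1 ≤ ‖t‖ → ∃ S' ⊆ S, S'.card = n ∧
        ∀ p ∈ S', ‖localCharFun α σ p t‖ ≤ D / √‖t‖ := by
  set κ : ℝ := 12 / (1 - (2 : ℝ) ^ (θ - 1 / 2)) ^ 2 with hκ
  have hκ0 : 0 ≤ κ := by positivity
  set f : Nat.Primes → EuclideanSpace ℂ (Fin J) → ℝ := fun p t =>
    ‖∑ j, (starRingEnd ℂ) (t j) * primePowerCoeff α j p 1‖ with hf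
  have hfc : ∀ p, Continuous (f p) := by
    intro p
    refine continuous_norm.comp (continuous_finsetSum _ fun j _ => ?_)
    refine (Complex.continuous_conj.comp ?_).mul continuous_const
    fun_prop
  obtain ⟨S, m, hm, hS⟩ := (isCompact_sphere (0 : EuclideanSpace ℂ (Fin J))
    1).exists_finset_forall_exists_subset hfc
    (a := fun p => κ * ((∑ j, ∑ i, ‖α j p i‖ ^ 2) / ((p : ℕ) : ℝ) ^ (1 / 2 : ℝ)))
    (fun p => by positivity) (fun t ht => by
      refine infinite_setOf_lt_norm_sum_mul_primePowerCoeff hθ hα hRam hSel hξ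
        (w := fun j => (starRingEnd ℂ) (t j)) ?_ κ
      intro h
      have h0 : t = 0 := by
        ext j
        have := congrFun h j
        simpa using this
      rw [h0] at ht
      simp at ht) n
  obtain ⟨A, hA, hA0⟩ : ∃ A : ℝ, (∀ p ∈ S, A < m / ((p : ℕ) : ℝ) ^ σ₀) ∧ 0 < A := by
    have : ∀ᶠ A : ℝ in 𝓝[>] 0, ∀ p ∈ S, A < m / ((p : ℕ) : ℝ) ^ σ₀ := by
      rw [Filter.eventually_all_finset]
      exact fun p _ => nhdsWithin_le_nhds
        (eventually_lt_nhds (div_pos hm (Real.rpow_pos_of_pos p.cast_pos _)))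
    exact (this.and self_mem_nhdsWithin).exists
  refine ⟨S, decayConst (J * d) ((2 : ℝ) ^ (θ - 1 / 2)) A, fun σ hσ hσ₀ t ht => ?_⟩
  have ht0 : 0 < ‖t‖ := by linarith
  set u : EuclideanSpace ℂ (Fin J) := ((‖t‖⁻¹ : ℝ) : ℂ) • t with hu
  have hun : ‖u‖ = 1 := by
    rw [hu, norm_smul, Complex.norm_real, norm_inv, norm_norm, inv_mul_cancel₀ ht0.ne']
  obtain ⟨S', hS', hcard, h⟩ := hS u (by simpa using hun)
  refine ⟨S', hS', hcard, fun p hp => ?_⟩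
  have hb := norm_integral_cexp_localLog_le hα hθ hσ hσ₀ p
    (w := fun j => (starRingEnd ℂ) (u j)) (fun j => by
      rw [RCLike.norm_conj, ← hun]; exact PiLp.norm_apply_le u j) hA0
    ((hA p (hS' hp)).le.trans (by
      have := (h p hp).2
      gcongr)) (h p hp).1 ht
  convert hb using 3
  rw [localCharFun]
  refine integral_congr_ae (Eventually.of_forall fun z => ?_)
  simp only
  congr 3
  rw [← Complex.re_ofReal_mul, Finset.mul_sum]
  congr 1
  refine Finset.sum_congr rfl fun j _ => ?_
  have ht1 : (‖t‖ : ℂ) ≠ 0 := by exact_mod_cast ht0.ne'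
  simp only [hu, PiLp.smul_apply, smul_eq_mul, map_mul, Complex.ofReal_inv]
  rw [map_inv₀, Complex.conj_ofReal]
  field_simp

/-- Among the primes of `S`, `2r` supply a factor `‖t‖^(-1/2)` each and all others at most `1`.
Allowing every `T ⊇ S` lets the bound survive the passage to the infinite product. -/
theorem exists_finset_prod_norm_localCharFun_le (hα : LocalRootBound α θ) (hθ : θ < 1 / 2)
    (hRam : RamanujanOnAverage α) {ξ : Fin J → ℝ} {c : Fin J → Fin J → ℂ}
    (hSel : SelbergOrthonormality α ξ c) (hξ : ∀ j, 0 < ξ j) (σ₀ : ℝ) (r : ℕ) :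
    ∃ S : Finset Nat.Primes, ∃ C : ℝ, ∀ σ, 1 / 2 ≤ σ → σ ≤ σ₀ →
      ∀ t : EuclideanSpace ℂ (Fin J), ∀ T, S ⊆ T →
        ∏ p ∈ T, ‖localCharFun α σ p t‖ ≤ C * (1 + ‖t‖) ^ (-(r : ℝ)) := by
  obtain ⟨S, D, hSD⟩ := exists_finset_norm_localCharFun_le hα hθ hRam hSel hξ σ₀ (2 * r)
  refine ⟨S, 2 ^ r * max 1 (D ^ (2 * r)), fun σ hσ hσ₀ t T hT => ?_⟩
  have ht0 : 0 ≤ ‖t‖ := norm_nonneg t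
  rw [Real.rpow_neg (by positivity), Real.rpow_natCast, ← div_eq_mul_inv,
    le_div_iff₀ (by positivity)]
  rcases le_total 1 ‖t‖ with ht | ht
  · obtain ⟨S', hS', hcard, h⟩ := hSD σ hσ hσ₀ t ht
    have h1 : ∏ p ∈ T, ‖localCharFun α σ p t‖ ≤ D ^ (2 * r) / ‖t‖ ^ r := by
      calc ∏ p ∈ T, ‖localCharFun α σ p t‖ ≤ ∏ p ∈ S', ‖localCharFun α σ p t‖ := by
            rw [← Finset.prod_sdiff (hS'.trans hT)]
            exact mul_le_of_le_one_left (Finset.prod_nonneg fun _ _ => norm_nonneg _)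
              (Finset.prod_le_one (fun _ _ => norm_nonneg _)
                fun p _ => norm_localCharFun_le_one p t)
        _ ≤ ∏ p ∈ S', D / √‖t‖ := Finset.prod_le_prod (fun _ _ => norm_nonneg _) h
        _ = D ^ (2 * r) / ‖t‖ ^ r := by
            rw [Finset.prod_const, hcard, div_pow, pow_mul (√‖t‖), Real.sq_sqrt ht0]
    have htr : 0 < ‖t‖ ^ r := by positivity
    have h3 : 0 ≤ ∏ p ∈ T, ‖localCharFun α σ p t‖ := by positivity
    calc (∏ p ∈ T, ‖localCharFun α σ p t‖) * (1 + ‖t‖) ^ r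
        ≤ D ^ (2 * r) / ‖t‖ ^ r * (2 * ‖t‖) ^ r := by
          gcongr
          · exact h3.trans h1
          · linarith
      _ = 2 ^ r * D ^ (2 * r) := by
          rw [mul_pow]; field_simp
      _ ≤ _ := by gcongr; exact le_max_right _ _
  · have h1 : ∏ p ∈ T, ‖localCharFun α σ p t‖ ≤ 1 :=
      Finset.prod_le_one (fun _ _ => norm_nonneg _) fun p _ => norm_localCharFun_le_one p t
    calc (∏ p ∈ T, ‖localCharFun α σ p t‖) * (1 + ‖t‖) ^ r ≤ 1 * 2 ^ r := by
          gcongr; linarith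
      _ = 2 ^ r * 1 := by ring
      _ ≤ _ := by gcongr; exact le_max_left _ _

end Decay

/-! ### The bounded density of the vector of logarithms. -/

section Density

variable {J d : ℕ} {α : Fin J → Nat.Primes → Fin d → ℂ} {θ σ : ℝ}
  {Ω : Type*} [MeasurableSpace Ω] {P : Measure Ω} {X : Nat.Primes → Ω → ℂ}

theorem IsRandomUnitSequence.integral_cexp_sum_localLog (hX : IsRandomUnitSequence P X)
    (t : Fin J → ℂ) (T : Finset Nat.Primes) :
    ∫ ω, Complex.exp (((∑ j, (starRingEnd ℂ) (t j) *
      ∑ p ∈ T, localLog α σ j p (X p ω)).re : ℝ) * Complex.I) ∂P =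
      ∏ p ∈ T, localCharFun α σ p t := by
  set F : Nat.Primes → ℂ → ℂ := fun p z =>
    Complex.exp (((∑ j, (starRingEnd ℂ) (t j) * localLog α σ j p z).re : ℝ) * Complex.I) with hF
  have hFm : ∀ p, Measurable (F p) := fun p => by
    have := fun j => measurable_localLog α σ j p
    fun_prop
  have h1 : ∀ ω, Complex.exp (((∑ j, (starRingEnd ℂ) (t j) *
      ∑ p ∈ T, localLog α σ j p (X p ω)).re : ℝ) * Complex.I) =
      ∏ p : T, F p (X p ω) := by
    intro ω
    rw [Finset.prod_coe_sort T fun p => F p (X p ω), ← Complex.exp_sum, ← Finset.sum_mul]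
    congr 2
    rw [← Complex.ofReal_sum, ← Complex.re_sum, Finset.sum_comm]
    simp only [Finset.mul_sum]
  simp only [h1]
  have hind : iIndepFun (fun p : T => X p) P := hX.indep.precomp Subtype.val_injective
  rw [hind.integral_fun_prod_comp (f := fun p : T => F p)
    (fun p => (hX.law p).aemeasurable) fun p => (hFm p).aestronglyMeasurable,
    Finset.prod_coe_sort T fun p => ∫ ω, F p (X p ω) ∂P]
  exact Finset.prod_congr rfl fun p _ => hX.integral_comp p (hFm p)

/-- The vector `(log L_1(σ, X), …, log L_J(σ, X))`. -/
noncomputable def randomLogVector (α : Fin J → Nat.Primes → Fin d → ℂ) (X : Nat.Primes → Ω → ℂ)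
    (σ : ℝ) (ω : Ω) : EuclideanSpace ℂ (Fin J) :=
  WithLp.toLp 2 fun j => randomLogL α X σ j ω

/-- This explains the conjugates in `localCharFun`: they make its exponent the real inner product
used by `charFun`. -/
theorem inner_euclideanSpace_complex (x t : EuclideanSpace ℂ (Fin J)) :
    inner ℝ x t = (∑ j, (starRingEnd ℂ) (t j) * x j).re := by
  simp [PiLp.inner_apply, Complex.inner]

theorem aemeasurable_randomLogVector (hα : LocalRootBound α θ) (hθ : θ < 1 / 2)
    (hRam : RamanujanOnAverage α) (hX : IsRandomUnitSequence P X) (hσ : 1 / 2 < σ) :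
    AEMeasurable (randomLogVector α X σ) P := by
  refine (WithLp.measurable_toLp 2 _).comp_aemeasurable (aemeasurable_pi_lambda _ fun j => ?_)
  refine aemeasurable_of_tendsto_metrizable_ae atTop
    (f := fun N ω => ∑ p ∈ primesUpTo N, localLog α σ j p (X p ω)) (fun N => ?_) ?_
  · exact Finset.aemeasurable_fun_sum _ fun p _ =>
      (measurable_localLog α σ j p).comp_aemeasurable (hX.law p).aemeasurable
  · filter_upwards [ae_tendsto_randomL hα hθ hRam hX hσ, hX.ae_norm_eq_one] with ω hω hω1
    exact (hω j).2.1.congr fun N => partialRandomLogL_eq_sum_localLog hα hθ hσ.le hω1 j N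

theorem norm_charFun_randomLogVector_le (hα : LocalRootBound α θ) (hθ : θ < 1 / 2)
    (hRam : RamanujanOnAverage α) (hX : IsRandomUnitSequence P X) (hσ : 1 / 2 < σ)
    {S : Finset Nat.Primes} {t : EuclideanSpace ℂ (Fin J)} {B : ℝ}
    (hB : ∀ T, S ⊆ T → ∏ p ∈ T, ‖localCharFun α σ p t‖ ≤ B) :
    ‖charFun (P.map (randomLogVector α X σ)) t‖ ≤ B := by
  have hprob : IsProbabilityMeasure P := hX.indep.isProbabilityMeasure
  have hm := aemeasurable_randomLogVector hα hθ hRam hX hσ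
  rw [charFun_apply, integral_map hm (by fun_prop)]
  simp only [inner_euclideanSpace_complex]
  have hlim : Tendsto (fun N => ∫ ω, Complex.exp (((∑ j, (starRingEnd ℂ) (t j) *
      ∑ p ∈ primesUpTo N, localLog α σ j p (X p ω)).re : ℝ) * Complex.I) ∂P) atTop
      (𝓝 (∫ ω, Complex.exp (((∑ j, (starRingEnd ℂ) (t j) *
        randomLogVector α X σ ω j).re : ℝ) * Complex.I) ∂P)) := by
    refine tendsto_integral_of_dominated_convergence (fun _ => 1) (fun N => ?_)
      (integrable_const _) (fun N => Eventually.of_forall fun ω => ?_) ?_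
    · have h1 : ∀ j p, AEMeasurable (fun ω => localLog α σ j p (X p ω)) P := fun j p =>
        (measurable_localLog α σ j p).comp_aemeasurable (hX.law p).aemeasurable
      have h2 : AEMeasurable (fun ω => ∑ j, (starRingEnd ℂ) (t j) *
          ∑ p ∈ primesUpTo N, localLog α σ j p (X p ω)) P :=
        Finset.aemeasurable_fun_sum _ fun j _ =>
          (Finset.aemeasurable_fun_sum _ fun p _ => h1 j p).const_mul _
      have h3 : Continuous fun z : ℂ => Complex.exp ((z.re : ℂ) * Complex.I) := by fun_prop
      exact (h3.measurable.comp_aemeasurable h2).aestronglyMeasurable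
    · rw [Complex.norm_exp_ofReal_mul_I]
    · filter_upwards [ae_tendsto_randomL hα hθ hRam hX hσ, hX.ae_norm_eq_one] with ω hω hω1
      have h3 : Continuous fun z : ℂ => Complex.exp ((z.re : ℂ) * Complex.I) := by fun_prop
      refine (h3.tendsto _).comp (tendsto_finsetSum _ fun j _ => Tendsto.const_mul _ ?_)
      exact (hω j).2.1.congr fun N => partialRandomLogL_eq_sum_localLog hα hθ hσ.le hω1 j N
  refine le_of_tendsto hlim.norm ?_
  filter_upwards [tendsto_primesUpTo.eventually_ge_atTop S] with N hN
  rw [hX.integral_cexp_sum_localLog, norm_prod]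
  exact hB _ hN

/-- The Euclidean and product volumes are both Haar measures, hence proportional; the factor need
not be computed. -/
theorem exists_volume_preimage_ofLp_le (J : ℕ) :
    ∃ c : NNReal, ∀ s : Set (Fin J → ℂ),
      volume {x : EuclideanSpace ℂ (Fin J) | (fun j => x j) ∈ s} ≤ c * volume s := by
  set e := PiLp.continuousLinearEquiv 2 ℝ (fun _ : Fin J => ℂ)
  have : (Measure.map e (volume : Measure (EuclideanSpace ℂ (Fin J)))).IsAddHaarMeasure :=
    e.isAddHaarMeasure_map volume
  refine ⟨(Measure.map e (volume : Measure (EuclideanSpace ℂ (Fin J)))).addHaarScalarFactor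
    volume, fun s => ?_⟩
  have h := Measure.isAddLeftInvariant_eq_smul
    (Measure.map e (volume : Measure (EuclideanSpace ℂ (Fin J)))) volume
  refine (Measure.le_map_apply e.continuous.measurable.aemeasurable s).trans_eq ?_
  exact congrArg (fun ν : Measure (Fin J → ℂ) => ν s) h

/-- The decay exponent is taken to be `2J + 1`, just above the real dimension `2J`, so that the
majorant of the characteristic function is integrable. -/
theorem exists_measure_randomLogVector_le (hα : LocalRootBound α θ) (hθ : θ < 1 / 2)
    (hRam : RamanujanOnAverage α) {ξ : Fin J → ℝ} {c : Fin J → Fin J → ℂ}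
    (hSel : SelbergOrthonormality α ξ c) (hξ : ∀ j, 0 < ξ j) (σ₀ : ℝ) :
    ∃ K : ℝ, 0 < K ∧ ∀ (Ω : Type*) [MeasurableSpace Ω] (P : Measure Ω)
      (X : Nat.Primes → Ω → ℂ), IsRandomUnitSequence P X → ∀ σ, 1 / 2 < σ → σ ≤ σ₀ →
      ∀ s : Set (Fin J → ℂ), P {ω | (fun j => randomLogL α X σ j ω) ∈ s} ≤
        ENNReal.ofReal K * volume s := by
  obtain ⟨S, C, hSC⟩ := exists_finset_prod_norm_localCharFun_le hα hθ hRam hSel hξ σ₀ (2 * J + 1)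
  obtain ⟨a, ha⟩ := exists_volume_preimage_ofLp_le J
  set g : EuclideanSpace ℂ (Fin J) → ℝ := fun t =>
    C * (1 + ‖t‖) ^ (-((2 * J + 1 : ℕ) : ℝ)) with hg
  have hgi : Integrable g := by
    refine (integrable_one_add_norm ?_).const_mul C
    have : Module.finrank ℝ (EuclideanSpace ℂ (Fin J)) = 2 * J := by
      rw [← Module.finrank_mul_finrank ℝ ℂ, Complex.finrank_real_complex, finrank_euclideanSpace,
        Fintype.card_fin]
    rw [this]
    exact_mod_cast Nat.lt_succ_self _
  set D : ℝ := ∫ ξ, g ((2 * Real.pi) • ξ) with hD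
  -- The `max` and the `+ 1` serve only to make the constant positive.
  refine ⟨max D 0 * a + 1, by positivity, fun Ω _ P X hX σ hσ hσ₀ s => ?_⟩
  have hprob : IsProbabilityMeasure P := hX.indep.isProbabilityMeasure
  have hle := measure_le_of_norm_charFun_le (P.map (randomLogVector α X σ)) hgi
    fun t => norm_charFun_randomLogVector_le hα hθ hRam hX hσ fun T hT =>
      hSC σ hσ.le hσ₀ t T hT
  calc P {ω | (fun j => randomLogL α X σ j ω) ∈ s}
      ≤ P.map (randomLogVector α X σ) {x | (fun j => x j) ∈ s} :=
        Measure.le_map_apply (aemeasurable_randomLogVector hα hθ hRam hX hσ) _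
    _ ≤ ENNReal.ofReal D * volume {x : EuclideanSpace ℂ (Fin J) | (fun j => x j) ∈ s} :=
        hle _
    _ ≤ ENNReal.ofReal D * (a * volume s) := by gcongr; exact ha s
    _ = ENNReal.ofReal (max D 0 * a) * volume s := by
        rw [ENNReal.ofReal_mul (le_max_right _ _), ENNReal.ofReal_coe_nnreal, ← mul_assoc]
        congr 2
        rcases le_total D 0 with h | h
        · rw [max_eq_right h, ENNReal.ofReal_of_nonpos h, ENNReal.ofReal_zero]
        · rw [max_eq_left h]
    _ ≤ _ := by gcongr; linarith

end Density

/-! ### The probability bound. -/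

theorem lemma2p7 {J d : ℕ} (hJ : 1 ≤ J)
    (α : Fin J → Nat.Primes → Fin d → ℂ)
    (θ : ℝ) (hθ0 : 0 ≤ θ) (hθ : θ < 1 / 2) (hα : LocalRootBound α θ)
    (hRam : RamanujanOnAverage α)
    (ξ : Fin J → ℝ) (hξ : ∀ j, 0 < ξ j) (c : Fin J → Fin J → ℂ)
    (hSel : SelbergOrthonormality α ξ c)
    (σ₀ : ℝ) :
    ∃ C : ℝ, 0 < C ∧
      ∀ (b : Fin J → ℝ), (∀ j, b j ≠ 0) → ∑ j, b j ^ 2 = 1 →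
      ∀ (Ω : Type*) [MeasurableSpace Ω] (P : Measure Ω) [IsProbabilityMeasure P]
        (X : Nat.Primes → Ω → ℂ), IsRandomUnitSequence P X →
      ∀ σ : ℝ, 1 / 2 < σ → σ ≤ σ₀ →
        (∀ᵐ ω ∂P, ∀ j,
          Tendsto (fun N => partialRandomL α X σ j N ω) atTop (𝓝 (randomL α X σ j ω)) ∧
          Tendsto (fun N => partialRandomLogL α X σ j N ω) atTop (𝓝 (randomLogL α X σ j ω)) ∧
          Complex.exp (randomLogL α X σ j ω) = randomL α X σ j ω) ∧
        ∀ ε R M : ℝ, 0 < ε → 0 < R → 2 * Real.pi < M →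
          P.real {ω | randomVector α X σ ω ∈ Set.Icc (fun _ => -M) (fun _ => M) ∧
              R < ‖randomF α b X σ ω‖ ∧ ‖randomF α b X σ ω‖ < R + ε}
            ≤ C * M ^ (2 * J - 1) * Real.exp (2 * M) * (R * ε + ε ^ 2) := by
  have hJ' : (0 : ℝ) < J := by exact_mod_cast hJ
  obtain ⟨K, hK, hdens⟩ := exists_measure_randomLogVector_le hα hθ hRam hSel hξ σ₀
  refine ⟨K * (2 ^ (2 * J - 2) * (8 * J)), by positivity, ?_⟩
  intro b hb hb1 Ω _ P _ X hX σ hσ hσ₀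
  have hae := ae_tendsto_randomL hα hθ hRam hX hσ
  refine ⟨hae, fun ε R M hε hR hM => ?_⟩
  have hM0 : 0 < M := by linarith [Real.pi_pos]
  -- Pigeonhole on `∑ b_j² = 1`; eliminating this coordinate costs a factor `1 / b_j² ≤ J` and so
  -- keeps `C` independent of `b`.
  obtain ⟨j, hj⟩ : ∃ j, (J : ℝ)⁻¹ ≤ b j ^ 2 := by
    by_contra h
    push Not at h
    have hne : (Finset.univ : Finset (Fin J)).Nonempty := ⟨⟨0, hJ⟩, Finset.mem_univ _⟩
    have := Finset.sum_lt_sum_of_nonempty hne fun j _ => h j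
    rw [hb1, Finset.sum_const, Finset.card_univ, Fintype.card_fin, nsmul_eq_mul,
      mul_inv_cancel₀ hJ'.ne'] at this
    exact lt_irrefl _ this
  set s : Set (Fin J → ℂ) := {z | (∀ i, z i ∈ complexBox M) ∧
    R < ‖∑ i, (b i : ℂ) * Complex.exp (z i)‖ ∧
    ‖∑ i, (b i : ℂ) * Complex.exp (z i)‖ < R + ε}
  set Q : ℝ := (2 * M) ^ (2 * J - 2) *
    (M * (Real.exp (2 * M) / b j ^ 2 * (8 * (R * ε + ε ^ 2)))) with hQ
  have hQ0 : 0 ≤ Q := by positivity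
  have hmeas : P {ω | randomVector α X σ ω ∈ Set.Icc (fun _ => -M) (fun _ => M) ∧
      R < ‖randomF α b X σ ω‖ ∧ ‖randomF α b X σ ω‖ < R + ε} ≤ ENNReal.ofReal (K * Q) := by
    calc P {ω | randomVector α X σ ω ∈ Set.Icc (fun _ => -M) (fun _ => M) ∧
          R < ‖randomF α b X σ ω‖ ∧ ‖randomF α b X σ ω‖ < R + ε}
        ≤ P {ω | (fun j => randomLogL α X σ j ω) ∈ s} := by
          -- Off a null set `exp (log L_j) = L_j`, so `log |L_j|` is the real part of `log L_j` and
          -- the event becomes a condition on the vector of logarithms.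
          refine measure_mono_ae ?_
          filter_upwards [hae] with ω hω hωs
          obtain ⟨hbox, hF⟩ := hωs
          have hexp : ∀ i, Complex.exp (randomLogL α X σ i ω) = randomL α X σ i ω :=
            fun i => (hω i).2.2
          refine ⟨fun i => ⟨?_, ?_⟩, ?_⟩
          · have h1 := hbox.1 (Sum.inl i)
            have h2 := hbox.2 (Sum.inl i)
            simp only [randomVector, Sum.elim_inl, ← hexp, Complex.norm_exp, Real.log_exp] at h1 h2
            exact abs_le.2 ⟨h1, h2⟩
          · exact abs_le.2 ⟨hbox.1 (Sum.inr i), hbox.2 (Sum.inr i)⟩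
          · simp only [hexp]
            exact hF
      _ ≤ ENNReal.ofReal K * volume s := hdens Ω P X hX σ hσ hσ₀ s
      _ ≤ ENNReal.ofReal K * ENNReal.ofReal Q := by
          gcongr
          exact volume_box_inter_expSum_annulus_le j (hb j) hM hR hε
      _ = _ := (ENNReal.ofReal_mul hK.le).symm
  refine (ENNReal.toReal_le_of_le_ofReal (by positivity) hmeas).trans ?_
  have hbj : 0 < b j ^ 2 := by have := hb j; positivity
  have hdiv : Real.exp (2 * M) / b j ^ 2 ≤ Real.exp (2 * M) * J := by
    rw [div_eq_mul_inv]
    gcongr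
    exact inv_le_of_inv_le₀ hJ' hj
  have hpow : M ^ (2 * J - 1) = M ^ (2 * J - 2) * M := by
    rw [← pow_succ]; congr 1; omega
  calc K * Q ≤ K * ((2 * M) ^ (2 * J - 2) *
        (M * (Real.exp (2 * M) * J * (8 * (R * ε + ε ^ 2))))) := by
        rw [hQ]; gcongr
    _ = _ := by rw [hpow, mul_pow]; ring
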